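/- **Theorem 2 (Lower bound of NDT).** Consider an interference network with $N_T\ge 2$ single-antenna transmitters, $N_R\ge 2$ single-antenna receivers and a library of $L\ge N_R$ independent files $W_1,\dots,W_L$, each uniform on the bit strings of length $F$. In time slot $t$ receiver $q$ observes $Y_q(t)=\sum_{p=1}^{N_T}h_{qp}(t)X_p(t)+Z_q(t)$, where for each receiver the noise $Z_q(t)$ is i.i.d. $\mathcal{CN}(0,1)$ over time, and the coefficients $h_{qp}(t)\in\mathbb C$ are i.i.d. with a distribution $\nu$ without atoms: either over $q,p$ and $t$, in which case $\int\log(1+|h|)\,d\nu(h)<\infty$ is assumed, or over $q,p$ and constant in $t$ (no further assumption). Let $\mu_T,\mu_R\ge 0$, $M_T=L\mu_T$, $M_R=L\mu_R$. A scheme consists, for every power $P$ and file size $F$, of: caching functions producing the cache contents $U_p=(\phi_{p,i}(W_i))_{i\le L}$ of transmitter $p$ and $V_q=(\psi_{q,i}(W_i))_{i\le L}$ of receiver $q$, with entropies $H(U_p)\le M_TF$ and $H(V_q)\le M_RF$ in bits, chosen independently of the demands and the channel; a block length $T$ depending on the demand vector $\mathbf d\in[L]^{N_R}$ and the channel realization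 $\mathbf H$; encoders mapping $(U_p,\mathbf d,\mathbf H)$ to a codeword $(X_p(t))_{t=1}^T$ with $\frac1T\sum_t|X_p(t)|^2\le P$; and decoders by which receiver $q$ estimates its requested file $W_{d_q}$ from $V_q$, $(Y_q(t))_{t=1}^T$, $\mathbf H$ and $\mathbf d$. A scheme is feasible if for almost all $\mathbf H$ and for all $P>0$ the error probability, maximized over $\mathbf d$ and $q$, tends to $0$ as $F\to\infty$. It uses no intra-file coding if every cached content $\phi_{p,i}(W_i)$, $\psi_{q,i}(W_i)$ consists of the bits of $W_i$ at some fixed set of positions. The normalized delivery time (NDT) of a scheme is $$\tau=\operatorname*{ess\,sup}_{\mathbf H}\ \limsup_{P\to\infty}\ \limsup_{F\to\infty}\ \frac{\max_{\mathbf d}T}{F/\log_2P},$$ and the minimum NDT $\tau^*$ is the infimum of $\tau$ over all feasible schemes. With $(x)^+=\max\{x,0\}$: (i) When arbitrary intra-file coding is allowed, $$\tau^*\ \ge\ \tau_{L1}=\max_{l,s_1,s_2}\ \frac1l\Big\{(s_1+s_2)-(N_T-l)s_2\mu_T-\Big(\frac{2s_2+s_1+1}{2}\,s_1+s_2^2\Big)\mu_R\Big\}.$$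 (ii) When the infimum is only over feasible schemes without intra-file coding, $$\tau^*\ \ge\ \tau_{L2}=\max_{l,s_1,s_2}\ \frac1l\Big\{(s_1+s_2)-(N_T-l)s_2\mu_T-\Big(\frac{2s_2+s_1+1}{2}\,s_1+s_2^2\Big)\mu_R+\Big(\frac{2s_2+s_1}{2}(s_1-1)+s_2^2\Big)(1-N_T\mu_T)^+\Big\}.$$ Both maxima are over integers $1\le l\le\min\{N_T,N_R\}$, $0\le s_1\le l$, $0\le s_2\le N_R-l$. -/

import Mathlib

open MeasureTheory ProbabilityTheory Filter Topology

noncomputable section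

/-! ### Random files and entropy -/

/-- A file of `F` bits; the `2 ^ F` bit strings of length `F` play the role of `{1, …, 2 ^ F}`. -/
abbrev CacheFile (F : ℕ) : Type := Fin F → Bool

/-- The contents of the database: `L` files of `F` bits each. The files are independent and
uniform, that is, the library is uniformly distributed on this finite type. -/
abbrev Library (L F : ℕ) : Type := Fin L → CacheFile F

open Classical in
/-- Shannon entropy, in bits, of the random variable `X ω` when `ω` is uniform on the finite
type `Ω`. -/
def entropyBits {Ω α : Type*} [Fintype Ω] (X : Ω → α) : ℝ :=
  ∑ y ∈ Finset.univ.image X,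
    Real.negMulLog (((Finset.univ.filter fun ω => X ω = y).card : ℝ) / Fintype.card Ω) /
      Real.log 2

/-! ### The channel -/

/-- A channel realization: `H t q p` is the coefficient from transmitter `p` to receiver `q` in
time slot `t`. -/
abbrev Channel (NT NR : ℕ) : Type := ℕ → Fin NR → Fin NT → ℂ

/-- The two usual readings of "i.i.d. channel coefficients": fresh coefficients in every time
slot, or coefficients that are drawn once and stay fixed during the transmission. -/
inductive Fading : Type
  | timeVarying : Fading
  | static : Fading

/-- The law of the channel when the coefficients are i.i.d. with distribution `ν`: over
transmitters, receivers and time slots (`timeVarying`), or over transmitters and receivers and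
constant in time (`static`). -/
def channelLaw (NT NR : ℕ) (ν : Measure ℂ) [IsProbabilityMeasure ν] :
    Fading → Measure (Channel NT NR)
  | .timeVarying =>
      Measure.infinitePi fun _ : ℕ => Measure.pi fun _ : Fin NR => Measure.pi fun _ : Fin NT => ν
  | .static =>
      (Measure.pi fun _ : Fin NR => Measure.pi fun _ : Fin NT => ν).map fun G (_ : ℕ) => G

/-- The circularly symmetric complex Gaussian distribution `CN(0, 1)`: independent real and
imaginary parts of variance `1 / 2`. -/
def stdComplexGaussian : Measure ℂ :=
  ((gaussianReal 0 (1 / 2)).prod (gaussianReal 0 (1 / 2))).map fun z : ℝ × ℝ => (⟨z.1, z.2⟩ : ℂ)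

/-- The law of the noise of one receiver during `T` time slots: i.i.d. `CN(0, 1)`. -/
def noiseLaw (T : ℕ) : Measure (Fin T → ℂ) := Measure.pi fun _ => stdComplexGaussian

/-! ### Caching and coding schemes -/

/-- A caching and coding scheme for files of `F` bits, transmitter caches of `MT * F` bits,
receiver caches of `MR * F` bits and power `P`. The caching functions act on each file separately
(no inter-file coding) and know neither the demands nor the channel. Cached contents are labelled
by natural numbers, their size is measured by entropy. -/
structure CachingCode (NT NR L F : ℕ) (MT MR P : ℝ) where
  /-- `φ p i`, the caching function of transmitter `p` for file `i` -/
  φ : Fin NT → Fin L → CacheFile F → ℕ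
  /-- `ψ q i`, the caching function of receiver `q` for file `i` -/
  ψ : Fin NR → Fin L → CacheFile F → ℕ
  tx_capacity : ∀ p, entropyBits (fun (W : Library L F) i => φ p i (W i)) ≤ MT * F
  rx_capacity : ∀ q, entropyBits (fun (W : Library L F) i => ψ q i (W i)) ≤ MR * F
  /-- the block length, given the demand vector and the channel realization -/
  T : (Fin NR → Fin L) → Channel NT NR → ℕ
  /-- `Λ p`, the encoding function of transmitter `p` -/
  Λ : ∀ (_ : Fin NT) (_ : Fin L → ℕ) (d : Fin NR → Fin L) (H : Channel NT NR), Fin (T d H) → ℂ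
  power : ∀ p (W : Library L F) d H,
    ∑ t, ‖Λ p (fun i => φ p i (W i)) d H t‖ ^ 2 ≤ T d H * P
  /-- `Γ q`, the decoding function of receiver `q` -/
  Γ : ∀ (_ : Fin NR) (_ : Fin L → ℕ) (d : Fin NR → Fin L) (H : Channel NT NR),
    (Fin (T d H) → ℂ) → CacheFile F
  measurable_Γ : ∀ q v d H, Measurable (Γ q v d H)

namespace CachingCode

variable {NT NR L F : ℕ} {MT MR P : ℝ} (C : CachingCode NT NR L F MT MR P)

/-- The codeword sent by transmitter `p`. -/
def codeword (p : Fin NT) (W : Library L F) (d : Fin NR → Fin L) (H : Channel NT NR) :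
    Fin (C.T d H) → ℂ :=
  C.Λ p (fun i => C.φ p i (W i)) d H

/-- The signal received by receiver `q` when its noise is `z`. -/
def received (q : Fin NR) (W : Library L F) (d : Fin NR → Fin L) (H : Channel NT NR)
    (z : Fin (C.T d H) → ℂ) : Fin (C.T d H) → ℂ :=
  fun t => ∑ p, H t q p * C.codeword p W d H t + z t

/-- The file that receiver `q` decodes when its noise is `z`. -/
def decoded (q : Fin NR) (W : Library L F) (d : Fin NR → Fin L) (H : Channel NT NR)
    (z : Fin (C.T d H) → ℂ) : CacheFile F :=
  C.Γ q (fun i => C.ψ q i (W i)) d H (C.received q W d H z)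

/-- The probability, over the uniform library and the noise, that receiver `q` fails to decode the
file that it requests. -/
def errorProb (d : Fin NR → Fin L) (q : Fin NR) (H : Channel NT NR) : ENNReal :=
  (∑ W : Library L F, noiseLaw (C.T d H) {z | C.decoded q W d H z ≠ W (d q)}) /
    (Fintype.card (Library L F) : ENNReal)

/-- The worst-case error probability for the channel realization `H`. -/
def worstErrorProb (H : Channel NT NR) : ENNReal :=
  ⨆ (d : Fin NR → Fin L) (q : Fin NR), C.errorProb d q H

/-- The worst-case block length for the channel realization `H`. -/
def maxT (H : Channel NT NR) : ℕ := Finset.univ.sup fun d : Fin NR → Fin L => C.T d H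

end CachingCode

/-- A caching function without intra-file coding: the cached content consists of the bits of the
file in some set `A` of positions (that is, knowing it amounts to knowing these bits). -/
def IsUncoded {F : ℕ} (f : CacheFile F → ℕ) : Prop :=
  ∃ A : Set (Fin F), ∀ w w' : CacheFile F, f w = f w' ↔ ∀ b ∈ A, w b = w' b

/-- A family of schemes, one for every power `P` and every file size `F`, at normalized cache
sizes `μT = MT / L` and `μR = MR / L`. -/
abbrev CachingScheme (NT NR L : ℕ) (μT μR : ℝ) : Type :=
  ∀ (P : ℝ) (F : ℕ), CachingCode NT NR L F (L * μT) (L * μR) P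

namespace CachingScheme

variable {NT NR L : ℕ} {μT μR : ℝ} (S : CachingScheme NT NR L μT μR)

/-- For almost all channel realizations the worst-case error probability vanishes as the file size
tends to infinity (at every power). -/
def Feasible (κ : Measure (Channel NT NR)) : Prop :=
  ∀ᵐ H ∂κ, ∀ P : ℝ, 0 < P → Tendsto (fun F : ℕ => (S P F).worstErrorProb H) atTop (𝓝 0)

/-- No caching function uses intra-file coding. -/
def NoIntraFileCoding : Prop :=
  ∀ (P : ℝ) (F : ℕ), (∀ p i, IsUncoded ((S P F).φ p i)) ∧ ∀ q i, IsUncoded ((S P F).ψ q i)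

/-- The normalized delivery time for the channel realization `H`. The outer limit is taken as an
upper limit, so that it is defined for every scheme. -/
def ndtAt (H : Channel NT NR) : EReal :=
  limsup (fun P : ℝ =>
    limsup (fun F : ℕ => ((((S P F).maxT H : ℝ) / (F / Real.logb 2 P) : ℝ) : EReal)) atTop) atTop

/-- The normalized delivery time of a scheme, over almost all channel realizations. -/
def ndt (κ : Measure (Channel NT NR)) : EReal := essSup S.ndtAt κ

end CachingScheme

/-- The minimum normalized delivery time with arbitrary intra-file coding. -/
def minNDT (NT NR L : ℕ) (μT μR : ℝ) (κ : Measure (Channel NT NR)) : EReal :=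
  sInf {τ | ∃ S : CachingScheme NT NR L μT μR, S.Feasible κ ∧ S.ndt κ = τ}

/-- The minimum normalized delivery time without intra-file coding. -/
def minNDTUncoded (NT NR L : ℕ) (μT μR : ℝ) (κ : Measure (Channel NT NR)) : EReal :=
  sInf {τ | ∃ S : CachingScheme NT NR L μT μR,
    S.Feasible κ ∧ S.NoIntraFileCoding ∧ S.ndt κ = τ}

/-! ### The two bounds (each is the maximum of a finite nonempty set of reals) -/

/-- The lower bound `τ_{L1}`. -/
def tauL1 (NT NR : ℕ) (μT μR : ℝ) : ℝ :=
  sSup {x | ∃ l s₁ s₂ : ℕ, 1 ≤ l ∧ l ≤ min NT NR ∧ s₁ ≤ l ∧ s₂ ≤ NR - l ∧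
    x = 1 / l * (((s₁ : ℝ) + s₂) - (NT - l) * s₂ * μT
      - ((2 * s₂ + s₁ + 1) / 2 * s₁ + s₂ ^ 2) * μR)}

/-- The lower bound `τ_{L2}`. -/
def tauL2 (NT NR : ℕ) (μT μR : ℝ) : ℝ :=
  sSup {x | ∃ l s₁ s₂ : ℕ, 1 ≤ l ∧ l ≤ min NT NR ∧ s₁ ≤ l ∧ s₂ ≤ NR - l ∧
    x = 1 / l * (((s₁ : ℝ) + s₂) - (NT - l) * s₂ * μT
      - ((2 * s₂ + s₁ + 1) / 2 * s₁ + s₂ ^ 2) * μR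
      + ((2 * s₂ + s₁) / 2 * (s₁ - 1) + s₂ ^ 2) * max (1 - NT * μT) 0)}

end

open scoped NNReal ENNReal

/-! ### Complex Gaussian densities -/

/-! Cut-set argument. Fix distinct demands, and let the active receivers be the first `s₁ ≤ l` and
`s₂` of those with index at least `l`. For almost every channel the leading `l × l` block is
invertible, so any output is a combination of the first `l` outputs, the inputs of the transmitters
`p ≥ l`, and noise. Hence the first `l` outputs and low-power residuals determine all active
requests, given these pieces of side information: the unrequested files, the caches of the
transmitters `p ≥ l` for files requested by active receivers `q ≥ l`, and the cache of active
receiver `q` for files requested by active `q' ≥ q`. Decoding goes through the receivers in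
increasing order: files of earlier receivers are known by then, and for `q ≥ l` the transmitters `p
≥ l` can be simulated. The observation carries about `T l log P` nats, the side information at most
its entropy. Mutual information never appears. Describing the library costs code length (`Codes`),
including a Fano-type term for each guess, and `log_card_sub_le_avg_codeLength` bounds this length
below as soon as all output laws are dominated by `exp E` times one probability measure. Gaussians
of inflated variance serve as this measure (`map_shear_noiseLaw_le`), and the power constraint
bounds `E` (`CachingCode.dominationExponent_le`). Slots whose block is singular or nearly so cost up
to `NR log P` more; by the strong law their proportion can be made arbitrarily small, and for static
fading there are none (`ae_isRegularChannel`). Cache capacities bound sums over all files. Averaging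
over cyclic demands makes each receiver request every file equally often, so each cache part costs
`μ F` bits on average (`CachingCode.mul_le_infoBound_maxT`). Finally `F → ∞`, then `P → ∞`
(`CachingScheme.le_ndtAt`). Without intra-file coding, a bit cached by no transmitter must be cached
by every receiver, since otherwise flipping it goes unnoticed. These common bits, a fraction of at
least `(1 - NT μT)⁺` of the library, need to be described once per requested file instead of once
per pair of receivers. This gain is the last term of the second bound. -/

theorem lintegral_fin_prod_eq_prod {n : ℕ} {α : Fin n → Type*} [∀ i, MeasurableSpace (α i)]
    (μ : ∀ i, Measure (α i)) [∀ i, SigmaFinite (μ i)] (f : ∀ i, α i → ℝ≥0∞)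
    (hf : ∀ i, Measurable (f i)) :
    ∫⁻ x, ∏ i, f i (x i) ∂(Measure.pi μ) = ∏ i, ∫⁻ x, f i x ∂(μ i) := by
  induction n with
  | zero => simp
  | succ n ih =>
    rw [← ((measurePreserving_piFinSuccAbove μ 0).symm _).lintegral_comp_emb
      (MeasurableEquiv.measurableEmbedding _)]
    simp only [Fin.prod_univ_succ]
    rw [lintegral_prod]
    · rw [← ih (fun i => μ i.succ) (fun i => f i.succ) fun i => hf _, ← lintegral_mul_const _ (hf 0)]
      refine lintegral_congr fun a => ?_
      rw [← lintegral_const_mul]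
      · rfl
      · exact Finset.measurable_prod _ fun i _ => (hf _).comp (measurable_pi_apply _)
    · refine Measurable.aemeasurable ?_
      refine Measurable.mul ((hf 0).comp measurable_fst) ?_
      exact Finset.measurable_prod _ fun i _ =>
        (hf _).comp ((measurable_pi_apply i).comp measurable_snd)

theorem pi_withDensity_fin {n : ℕ} {α : Fin n → Type*} [∀ i, MeasurableSpace (α i)]
    (μ : ∀ i, Measure (α i)) [∀ i, SigmaFinite (μ i)] (f : ∀ i, α i → ℝ≥0∞)
    (hf : ∀ i, Measurable (f i)) [∀ i, SigmaFinite ((μ i).withDensity (f i))] :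
    Measure.pi (fun i => (μ i).withDensity (f i)) =
      (Measure.pi μ).withDensity fun x => ∏ i, f i (x i) := by
  refine Measure.pi_eq fun s hs => ?_
  rw [withDensity_apply _ (MeasurableSet.univ_pi hs), Measure.restrict_pi_pi,
    lintegral_fin_prod_eq_prod _ f hf]
  exact Finset.prod_congr rfl fun i _ => (withDensity_apply _ (hs i)).symm

/-- The density of the circularly symmetric complex Gaussian distribution of variance `v`. -/
noncomputable def complexGaussianPDF (v : ℝ) (z : ℂ) : ℝ :=
  (Real.pi * v)⁻¹ * Real.exp (-(‖z‖ ^ 2 / v))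

theorem complexGaussianPDF_nonneg {v : ℝ} (hv : 0 ≤ v) (z : ℂ) : 0 ≤ complexGaussianPDF v z := by
  unfold complexGaussianPDF; positivity

theorem measurable_complexGaussianPDF (v : ℝ) : Measurable (complexGaussianPDF v) := by
  unfold complexGaussianPDF; fun_prop

/-- The circularly symmetric complex Gaussian distribution of variance `v`. -/
noncomputable def complexGaussian (v : ℝ) : Measure ℂ :=
  volume.withDensity fun z => ENNReal.ofReal (complexGaussianPDF v z)

theorem map_prod_gaussianReal (v : ℝ≥0) (hv : v ≠ 0) :
    ((gaussianReal 0 (v / 2)).prod (gaussianReal 0 (v / 2))).map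
      (fun z : ℝ × ℝ => (⟨z.1, z.2⟩ : ℂ)) = complexGaussian v := by
  have hv2 : v / 2 ≠ 0 := by positivity
  have hvpos : (0 : ℝ) < v := by positivity
  rw [gaussianReal_of_var_ne_zero _ hv2,
    prod_withDensity (measurable_gaussianPDF _ _) (measurable_gaussianPDF _ _)]
  have he : (fun z : ℝ × ℝ => (⟨z.1, z.2⟩ : ℂ)) = Complex.measurableEquivRealProd.symm := rfl
  rw [he]
  ext s hs
  have hmp := Complex.volume_preserving_equiv_real_prod.symm
  rw [MeasurableEquiv.map_apply, withDensity_apply _ (MeasurableEquiv.measurable _ hs),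
    complexGaussian, withDensity_apply _ hs,
    ← hmp.setLIntegral_comp_preimage_emb (MeasurableEquiv.measurableEmbedding _)]
  refine lintegral_congr fun z => ?_
  simp only [gaussianPDF]
  rw [← ENNReal.ofReal_mul (gaussianPDFReal_nonneg _ _ _)]
  congr 1
  have hn : ‖Complex.measurableEquivRealProd.symm z‖ ^ 2 = z.1 ^ 2 + z.2 ^ 2 := by
    rw [← Complex.normSq_eq_norm_sq, Complex.normSq_apply]
    simp [Complex.measurableEquivRealProd, sq]
  simp only [gaussianPDFReal, complexGaussianPDF, hn]
  rw [mul_mul_mul_comm, ← Real.exp_add, ← mul_inv, Real.mul_self_sqrt (by positivity)]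
  push_cast
  congr 2
  · field_simp
  · field_simp; ring

theorem stdComplexGaussian_eq : stdComplexGaussian = complexGaussian 1 := by
  have := map_prod_gaussianReal 1 one_ne_zero
  simpa [stdComplexGaussian] using this

theorem isProbabilityMeasure_complexGaussian {v : ℝ} (hv : 0 < v) :
    IsProbabilityMeasure (complexGaussian v) := by
  lift v to ℝ≥0 using hv.le
  rw [← map_prod_gaussianReal v (by exact_mod_cast hv.ne')]
  refine Measure.isProbabilityMeasure_map (Measurable.aemeasurable ?_)
  exact Complex.measurableEquivRealProd.symm.measurable

instance : IsProbabilityMeasure stdComplexGaussian := by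
  rw [stdComplexGaussian_eq]; exact isProbabilityMeasure_complexGaussian one_pos

instance (T : ℕ) : IsProbabilityMeasure (noiseLaw T) := by
  unfold noiseLaw; infer_instance

/-- The joint density of independent complex Gaussian variables with variances `v q t`. -/
noncomputable def gaussianArrayPDF {n T : ℕ} (v : Fin n → Fin T → ℝ) (y : Fin n → Fin T → ℂ) : ℝ :=
  ∏ q, ∏ t, complexGaussianPDF (v q t) (y q t)

theorem gaussianArrayPDF_nonneg {n T : ℕ} {v : Fin n → Fin T → ℝ} (hv : ∀ q t, 0 ≤ v q t)
    (y : Fin n → Fin T → ℂ) : 0 ≤ gaussianArrayPDF v y :=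
  Finset.prod_nonneg fun q _ => Finset.prod_nonneg fun t _ => complexGaussianPDF_nonneg (hv q t) _

theorem measurable_gaussianArrayPDF {n T : ℕ} (v : Fin n → Fin T → ℝ) :
    Measurable (gaussianArrayPDF v) := by
  unfold gaussianArrayPDF
  have := measurable_complexGaussianPDF
  refine Finset.measurable_prod _ fun q _ => Finset.measurable_prod _ fun t _ => ?_
  exact (this _).comp (by fun_prop)

theorem pi_pi_complexGaussian {n T : ℕ} {v : Fin n → Fin T → ℝ} (hv : ∀ q t, 0 < v q t) :
    (Measure.pi fun q => Measure.pi fun t => complexGaussian (v q t)) =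
      volume.withDensity fun y => ENNReal.ofReal (gaussianArrayPDF v y) := by
  have hpr := fun q t => isProbabilityMeasure_complexGaussian (hv q t)
  have hme : ∀ q t, Measurable fun z => ENNReal.ofReal (complexGaussianPDF (v q t) z) :=
    fun q t => (measurable_complexGaussianPDF _).ennreal_ofReal
  have h1 : ∀ q, (Measure.pi fun t => complexGaussian (v q t)) =
      volume.withDensity fun y : Fin T → ℂ =>
        ∏ t, ENNReal.ofReal (complexGaussianPDF (v q t) (y t)) := by
    intro q
    have : ∀ t, SigmaFinite ((volume : Measure ℂ).withDensity fun z =>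
      ENNReal.ofReal (complexGaussianPDF (v q t) z)) := fun t => by
      have := hpr q t
      unfold complexGaussian at this; infer_instance
    exact pi_withDensity_fin (fun _ => volume) _ (hme q)
  have h2 : ∀ q, SigmaFinite ((volume : Measure (Fin T → ℂ)).withDensity fun y =>
      ∏ t, ENNReal.ofReal (complexGaussianPDF (v q t) (y t))) := fun q => by
    rw [← h1]; infer_instance
  simp_rw [h1]
  rw [pi_withDensity_fin (fun _ => volume) _ fun q => ?_]
  · congr 1
    ext y
    rw [gaussianArrayPDF, ENNReal.ofReal_prod_of_nonneg fun q _ => Finset.prod_nonneg fun t _ =>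
      complexGaussianPDF_nonneg (hv q t).le _]
    refine Finset.prod_congr rfl fun q _ => ?_
    rw [ENNReal.ofReal_prod_of_nonneg fun t _ => complexGaussianPDF_nonneg (hv q t).le _]
  · exact Finset.measurable_prod _ fun t _ => (hme q t).comp (measurable_pi_apply t)

theorem pi_noiseLaw (n T : ℕ) : (Measure.pi fun _ : Fin n => noiseLaw T) =
    volume.withDensity fun y => ENNReal.ofReal (gaussianArrayPDF (fun _ _ => 1) y) := by
  rw [← pi_pi_complexGaussian fun _ _ => one_pos]
  simp only [noiseLaw, stdComplexGaussian_eq]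

/-! ### Domination of shifted and sheared Gaussian noise -/

/-- A translation followed by a shear preserves the product of invariant measures, so the image has
density `f (y - x) * f' (m - ξ + A (y - x))` at `(y, m)` and a pointwise comparison of densities
suffices. -/
theorem map_shear_withDensity_le {E E' : Type*} [AddCommGroup E] [AddCommGroup E']
    [MeasurableSpace E] [MeasurableSpace E'] [MeasurableAdd₂ E] [MeasurableAdd₂ E']
    [MeasurableSub₂ E] [MeasurableSub₂ E']
    (μ : Measure E) (μ' : Measure E') [SigmaFinite μ] [SigmaFinite μ'] [μ.IsAddLeftInvariant]
    [μ'.IsAddLeftInvariant] {f g : E → ℝ≥0∞} {f' g' : E' → ℝ≥0∞} (hf : Measurable f)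
    (hf' : Measurable f') (hg : Measurable g) (hg' : Measurable g')
    [SFinite (μ'.withDensity f')] [SFinite (μ'.withDensity g')]
    {A : E → E'} (hA : Measurable A) (x : E) (ξ : E') (C : ℝ≥0∞)
    (h : ∀ y m, f (y - x) * f' (m - ξ + A (y - x)) ≤ C * (g y * g' m)) :
    ((μ.withDensity f).prod (μ'.withDensity f')).map
        (fun z => (x + z.1, ξ - A z.1 + z.2)) ≤
      C • (μ.withDensity g).prod (μ'.withDensity g') := by
  have hmp : MeasurePreserving (fun z : E × E' => (x + z.1, ξ - A z.1 + z.2))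
      (μ.prod μ') (μ.prod μ') := by
    refine (measurePreserving_add_left μ x).skew_product (g := fun z z' => ξ - A z + z') ?_ ?_
    · exact (measurable_const.sub (hA.comp measurable_fst)).add measurable_snd
    · exact ae_of_all _ fun z => (measurePreserving_add_left μ' _).map_eq
  rw [prod_withDensity hf hf', prod_withDensity hg hg']
  have hh : Measurable fun p : E × E' => f (p.1 - x) * f' (p.2 - ξ + A (p.1 - x)) := by
    refine (hf.comp (measurable_fst.sub_const x)).mul (hf'.comp ?_)
    exact (measurable_snd.sub_const ξ).add (hA.comp (measurable_fst.sub_const x))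
  refine Measure.le_iff.2 fun S hS => ?_
  rw [Measure.map_apply hmp.measurable hS, withDensity_apply _ (hmp.measurable hS),
    Measure.smul_apply, withDensity_apply _ hS, smul_eq_mul]
  have h1 := hmp.setLIntegral_comp_preimage hS hh
  have h2 : ∀ z : E × E', f z.1 * f' z.2 =
      (fun p : E × E' => f (p.1 - x) * f' (p.2 - ξ + A (p.1 - x)))
        (x + z.1, ξ - A z.1 + z.2) := by
    intro z
    simp only [add_sub_cancel_left]
    congr 2
    abel
  simp only [h2]
  have hgg : Measurable fun p : E × E' => g p.1 * g' p.2 :=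
    (hg.comp measurable_fst).mul (hg'.comp measurable_snd)
  rw [h1, ← lintegral_const_mul _ hgg]
  exact lintegral_mono fun p => h p.1 p.2

theorem complexGaussianPDF_eq_exp {v : ℝ} (hv : 0 < v) (z : ℂ) :
    complexGaussianPDF v z = Real.exp (-Real.log (Real.pi * v) - ‖z‖ ^ 2 / v) := by
  rw [complexGaussianPDF, sub_eq_add_neg, Real.exp_add, Real.exp_neg (Real.log _),
    Real.exp_log (by positivity)]

theorem gaussianArrayPDF_eq_exp {n T : ℕ} {v : Fin n → Fin T → ℝ} (hv : ∀ q t, 0 < v q t)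
    (y : Fin n → Fin T → ℂ) :
    gaussianArrayPDF v y =
      Real.exp (∑ t, ∑ q, (-Real.log (Real.pi * v q t) - ‖y q t‖ ^ 2 / v q t)) := by
  simp_rw [Real.exp_sum]
  rw [Finset.prod_comm, gaussianArrayPDF]
  exact Finset.prod_congr rfl fun q _ => Finset.prod_congr rfl fun t _ =>
    complexGaussianPDF_eq_exp (hv q t) _

/-- Completing the square: shifting by `x` costs at most `‖x‖² / B` when the variance grows by a
factor `1 + B`. -/
theorem norm_sq_div_le_norm_sub_sq {B : ℝ} (hB : 0 ≤ B) {x : ℂ} (hx : B = 0 → x = 0) (y : ℂ) :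
    ‖y‖ ^ 2 / (1 + B) ≤ ‖y - x‖ ^ 2 + ‖x‖ ^ 2 / B := by
  rcases hB.eq_or_lt with h0 | hpos
  · simp [hx h0.symm, ← h0]
  · have h1 : ‖y‖ ≤ ‖y - x‖ + ‖x‖ := by simpa using norm_add_le (y - x) x
    have h2 : ‖y‖ ^ 2 ≤ (‖y - x‖ + ‖x‖) ^ 2 := by gcongr
    rw [div_le_iff₀ (by positivity)]
    have h3 : (‖y - x‖ ^ 2 + ‖x‖ ^ 2 / B) * (1 + B) - (‖y - x‖ + ‖x‖) ^ 2 =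
        (B * ‖y - x‖ - ‖x‖) ^ 2 / B := by field_simp; ring
    have : 0 ≤ (B * ‖y - x‖ - ‖x‖) ^ 2 / B := by positivity
    linarith

/-- Undoing the shear costs a bounded multiple of `∑ ‖z q‖ ^ 2`, by Cauchy–Schwarz and `‖u - v‖² ≤
2‖u‖² + 2‖v‖²`. -/
theorem sum_norm_sq_le_of_shear {n : ℕ} {a : Fin n → Fin n → ℂ} {K : ℝ}
    (ha : ∀ q q', ‖a q q'‖ ^ 2 ≤ K) (r z : Fin n → ℂ) :
    ∑ q, ‖r q‖ ^ 2 ≤ 2 * ∑ q, ‖r q + ∑ q', a q q' * z q'‖ ^ 2 + 2 * n ^ 2 * K * ∑ q, ‖z q‖ ^ 2 := by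
  have hz : ∀ q, ‖∑ q', a q q' * z q'‖ ^ 2 ≤ n * K * ∑ q', ‖z q'‖ ^ 2 := by
    intro q
    calc ‖∑ q', a q q' * z q'‖ ^ 2 ≤ (∑ q', ‖a q q' * z q'‖) ^ 2 := by
          gcongr; exact norm_sum_le _ _
      _ ≤ Finset.card (Finset.univ : Finset (Fin n)) * ∑ q', ‖a q q' * z q'‖ ^ 2 :=
          sq_sum_le_card_mul_sum_sq
      _ = n * ∑ q', ‖a q q'‖ ^ 2 * ‖z q'‖ ^ 2 := by simp [mul_pow]
      _ ≤ n * ∑ q', K * ‖z q'‖ ^ 2 := by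
          gcongr; exact ha _ _
      _ = n * K * ∑ q', ‖z q'‖ ^ 2 := by rw [← Finset.mul_sum]; ring
  have h1 : ∀ q, ‖r q‖ ^ 2 ≤ 2 * ‖r q + ∑ q', a q q' * z q'‖ ^ 2 +
      2 * (n * K * ∑ q', ‖z q'‖ ^ 2) := by
    intro q
    have h2 : ‖r q‖ ≤ ‖r q + ∑ q', a q q' * z q'‖ + ‖∑ q', a q q' * z q'‖ := by
      simpa using norm_sub_le (r q + ∑ q', a q q' * z q') (∑ q', a q q' * z q')
    have h3 : ‖r q‖ ^ 2 ≤ (‖r q + ∑ q', a q q' * z q'‖ + ‖∑ q', a q q' * z q'‖) ^ 2 := by gcongr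
    nlinarith [hz q, sq_nonneg (‖r q + ∑ q', a q q' * z q'‖ - ‖∑ q', a q q' * z q'‖)]
  refine (Finset.sum_le_sum fun q _ => h1 q).trans ?_
  rw [Finset.sum_add_distrib, ← Finset.mul_sum, Finset.sum_const, Finset.card_univ, Fintype.card_fin,
    nsmul_eq_mul]
  apply le_of_eq; ring

/-- The logarithm of the density ratio between shifted noise and noise of larger variance. -/
noncomputable def dominationExponent {n T : ℕ} (κ : ℝ) (B B' : Fin n → Fin T → ℝ)
    (x ξ : Fin n → Fin T → ℂ) : ℝ :=
  ∑ t, ∑ q, (Real.log (2 * (1 + B q t)) + Real.log (κ * (1 + B' q t)) +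
    ‖x q t‖ ^ 2 / B q t + ‖ξ q t‖ ^ 2 / B' q t)

/-- In each slot, half of the exponent `∑ ‖(y - x) q t‖ ^ 2` absorbs the shear, which needs `κ ≥ 4
(n² K + 1)`. Only the other half is left to pay for the shift by `x`, hence the factor `2` in the
first variance. Neither factor depends on the power. -/
theorem gaussianArrayPDF_mul_le {n T : ℕ} {a : Fin T → Fin n → Fin n → ℂ} {K κ : ℝ}
    (ha : ∀ t q q', ‖a t q q'‖ ^ 2 ≤ K) (hκ : 4 * (n ^ 2 * K + 1) ≤ κ) (hK : 0 ≤ K)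
    {B B' : Fin n → Fin T → ℝ} (hB : ∀ q t, 0 ≤ B q t) (hB' : ∀ q t, 0 ≤ B' q t)
    {x ξ : Fin n → Fin T → ℂ} (hx : ∀ q t, B q t = 0 → x q t = 0)
    (hξ : ∀ q t, B' q t = 0 → ξ q t = 0) (y m : Fin n → Fin T → ℂ) :
    gaussianArrayPDF (fun _ _ => 1) (y - x) *
        gaussianArrayPDF (fun _ _ => 1)
          (m - ξ + fun q t => ∑ q', a t q q' * (y - x) q' t) ≤
      Real.exp (dominationExponent κ B B' x ξ) *
        (gaussianArrayPDF (fun q t => 2 * (1 + B q t)) y *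
          gaussianArrayPDF (fun q t => κ * (1 + B' q t)) m) := by
  have hn2 : (0 : ℝ) ≤ n ^ 2 * K := by positivity
  have hκ4 : 4 ≤ κ := by linarith
  have hκ0 : 0 < κ := by linarith
  have hv : ∀ q t, 0 < 2 * (1 + B q t) := fun q t => by linarith [hB q t]
  have hv' : ∀ q t, 0 < κ * (1 + B' q t) := fun q t => mul_pos hκ0 (by linarith [hB' q t])
  rw [gaussianArrayPDF_eq_exp (fun _ _ => one_pos), gaussianArrayPDF_eq_exp (fun _ _ => one_pos),
    gaussianArrayPDF_eq_exp hv, gaussianArrayPDF_eq_exp hv', dominationExponent,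
    ← Real.exp_add, ← Real.exp_add, ← Real.exp_add]
  refine Real.exp_le_exp.2 ?_
  simp only [← Finset.sum_add_distrib]
  refine Finset.sum_le_sum fun t _ => ?_
  have hsh := sum_norm_sq_le_of_shear (ha t) (fun q => m q t - ξ q t) (fun q => (y - x) q t)
  set Y := ∑ q, ‖(y - x) q t‖ ^ 2 with hY
  set S := ∑ q, ‖m q t - ξ q t + ∑ q', a t q q' * (y - x) q' t‖ ^ 2 with hS
  set R := ∑ q, ‖m q t - ξ q t‖ ^ 2 with hR
  have hY0 : 0 ≤ Y := Finset.sum_nonneg fun _ _ => by positivity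
  have hS0 : 0 ≤ S := Finset.sum_nonneg fun _ _ => by positivity
  have hRκ : R / κ ≤ S / 2 + Y / 2 := by
    rw [div_le_iff₀ hκ0]
    have h1 : 4 * S ≤ κ * S := by gcongr
    have h2 : 4 * (n ^ 2 * K + 1) * Y ≤ κ * Y := by gcongr
    nlinarith
  have key : ∑ q, (‖m q t - ξ q t‖ ^ 2 / κ + ‖(y - x) q t‖ ^ 2 / 2) ≤
      ∑ q, (‖(y - x) q t‖ ^ 2 + ‖m q t - ξ q t + ∑ q', a t q q' * (y - x) q' t‖ ^ 2) := by
    rw [Finset.sum_add_distrib, Finset.sum_add_distrib, ← Finset.sum_div, ← Finset.sum_div]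
    linarith
  rw [← sub_nonneg, ← Finset.sum_sub_distrib]
  rw [← sub_nonneg, ← Finset.sum_sub_distrib] at key
  refine key.trans (Finset.sum_le_sum fun q _ => ?_)
  have e1 := norm_sq_div_le_norm_sub_sq (hB q t) (hx q t) (y q t)
  have e2 := norm_sq_div_le_norm_sub_sq (hB' q t) (hξ q t) (m q t)
  have hb := hB q t
  have hb' := hB' q t
  have p1 : 0 ≤ ‖x q t‖ ^ 2 / B q t := by positivity
  have p2 : 0 ≤ ‖ξ q t‖ ^ 2 / B' q t := by positivity
  have e3 : ‖m q t‖ ^ 2 / (κ * (1 + B' q t)) ≤ ‖m q t - ξ q t‖ ^ 2 / κ + ‖ξ q t‖ ^ 2 / B' q t := by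
    have h1 : ‖m q t‖ ^ 2 / (κ * (1 + B' q t)) = ‖m q t‖ ^ 2 / (1 + B' q t) / κ := by
      rw [mul_comm, div_div]
    rw [h1]
    calc _ ≤ (‖m q t - ξ q t‖ ^ 2 + ‖ξ q t‖ ^ 2 / B' q t) / κ := by gcongr
      _ = ‖m q t - ξ q t‖ ^ 2 / κ + ‖ξ q t‖ ^ 2 / B' q t / κ := add_div _ _ _
      _ ≤ _ := add_le_add le_rfl (div_le_self p2 (by linarith))
  have e4 : ‖y q t‖ ^ 2 / (2 * (1 + B q t)) ≤ ‖(y - x) q t‖ ^ 2 / 2 + ‖x q t‖ ^ 2 / B q t := by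
    have h1 : ‖y q t‖ ^ 2 / (2 * (1 + B q t)) = ‖y q t‖ ^ 2 / (1 + B q t) / 2 := by
      rw [mul_comm, div_div]
    rw [h1]
    simp only [Pi.sub_apply]
    linarith
  have l1 := Real.log_mul Real.pi_ne_zero (hv q t).ne'
  have l2 := Real.log_mul Real.pi_ne_zero (hv' q t).ne'
  simp only [mul_one, div_one, Pi.add_apply, Pi.sub_apply] at *
  rw [l1, l2]
  linarith

/-- The point is that one `Q` serves all shifts, because its variances depend on `B` and `B'` only.
The exponent then plays the role of the channel capacity. -/
theorem map_shear_noiseLaw_le {n T : ℕ} {a : Fin T → Fin n → Fin n → ℂ} {K κ : ℝ}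
    (ha : ∀ t q q', ‖a t q q'‖ ^ 2 ≤ K) (hκ : 4 * (n ^ 2 * K + 1) ≤ κ) (hK : 0 ≤ K)
    {B B' : Fin n → Fin T → ℝ} (hB : ∀ q t, 0 ≤ B q t) (hB' : ∀ q t, 0 ≤ B' q t) :
    ∃ Q : Measure ((Fin n → Fin T → ℂ) × (Fin n → Fin T → ℂ)), IsProbabilityMeasure Q ∧
      ∀ (x ξ : Fin n → Fin T → ℂ), (∀ q t, B q t = 0 → x q t = 0) →
        (∀ q t, B' q t = 0 → ξ q t = 0) →
        ((Measure.pi fun _ : Fin n => noiseLaw T).prod (Measure.pi fun _ : Fin n => noiseLaw T)).map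
          (fun z => (x + z.1, ξ - (fun q t => ∑ q', a t q q' * z.1 q' t) + z.2)) ≤
          ENNReal.ofReal (Real.exp (dominationExponent κ B B' x ξ)) • Q := by
  have hn2 : (0 : ℝ) ≤ n ^ 2 * K := by positivity
  have hκ0 : 0 < κ := by linarith
  have hv : ∀ q t, 0 < 2 * (1 + B q t) := fun q t => by linarith [hB q t]
  have hv' : ∀ q t, 0 < κ * (1 + B' q t) := fun q t => mul_pos hκ0 (by linarith [hB' q t])
  have hpr := fun q t => isProbabilityMeasure_complexGaussian (hv q t)
  have hpr' := fun q t => isProbabilityMeasure_complexGaussian (hv' q t)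
  have i1 := (pi_pi_complexGaussian hv).symm
  have i2 := (pi_pi_complexGaussian hv').symm
  have i3 := (pi_noiseLaw n T).symm
  refine ⟨(volume.withDensity fun y =>
      ENNReal.ofReal (gaussianArrayPDF (fun q t => 2 * (1 + B q t)) y)).prod
    (volume.withDensity fun y =>
      ENNReal.ofReal (gaussianArrayPDF (fun q t => κ * (1 + B' q t)) y)), ?_, fun x ξ hx hξ => ?_⟩
  · rw [i1, i2]; infer_instance
  · rw [pi_noiseLaw]
    have s1 : SFinite ((volume : Measure (Fin n → Fin T → ℂ)).withDensity fun y =>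
      ENNReal.ofReal (gaussianArrayPDF (fun _ _ => 1) y)) := by rw [i3]; infer_instance
    have s2 : SFinite ((volume : Measure (Fin n → Fin T → ℂ)).withDensity fun y =>
      ENNReal.ofReal (gaussianArrayPDF (fun q t => κ * (1 + B' q t)) y)) := by
      rw [i2]; infer_instance
    refine map_shear_withDensity_le _ _ (measurable_gaussianArrayPDF _).ennreal_ofReal
      (measurable_gaussianArrayPDF _).ennreal_ofReal (measurable_gaussianArrayPDF _).ennreal_ofReal
      (measurable_gaussianArrayPDF _).ennreal_ofReal
      (A := fun z => fun q t => ∑ q', a t q q' * z q' t) ?_ x ξ _ fun y m => ?_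
    · fun_prop
    · rw [← ENNReal.ofReal_mul (gaussianArrayPDF_nonneg (fun _ _ => zero_le_one) _),
        ← ENNReal.ofReal_mul (gaussianArrayPDF_nonneg (fun q t => (hv q t).le) _),
        ← ENNReal.ofReal_mul (Real.exp_nonneg _)]
      exact ENNReal.ofReal_le_ofReal (gaussianArrayPDF_mul_le ha hκ hK hB hB' hx hξ y m)

/-! ### Code lengths -/

/-- A version of Gibbs' inequality: if the laws `P w` are dominated by `exp c • Q`, then describing
`w` given the observation takes at least `log |Ω| - c` nats on average. -/
theorem log_card_sub_le_avg_codeLength {Ω 𝒴 : Type*} [Fintype Ω] [Nonempty Ω] [MeasurableSpace 𝒴]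
    (P : Ω → Measure 𝒴) [∀ w, IsProbabilityMeasure (P w)] (Q : Measure 𝒴) [IsProbabilityMeasure Q]
    {c δ : ℝ} (hdom : ∀ w, P w ≤ ENNReal.ofReal (Real.exp c) • Q) {r : Ω → 𝒴 → ℝ} (hδ : 0 < δ)
    (hr : ∀ w y, δ ≤ r w y) (hm : ∀ w, Measurable (r w)) (hsum : ∀ y, ∑ w, r w y ≤ 1) :
    Real.log (Fintype.card Ω) - c ≤
      (∑ w, ∫ y, -Real.log (r w y) ∂(P w)) / Fintype.card Ω := by
  have hN : (0 : ℝ) < Fintype.card Ω := by exact_mod_cast Fintype.card_pos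
  set N : ℝ := (Fintype.card Ω : ℝ) with hNdef
  have hr0 : ∀ w y, 0 < r w y := fun w y => hδ.trans_le (hr w y)
  have hr1 : ∀ w y, r w y ≤ 1 := fun w y =>
    (Finset.single_le_sum (f := fun w => r w y) (fun w _ => (hr0 w y).le)
      (Finset.mem_univ w)).trans (hsum y)
  have hri : ∀ w (μ : Measure 𝒴) [IsProbabilityMeasure μ], Integrable (r w) μ := fun w μ _ =>
    Integrable.of_bound (hm w).aestronglyMeasurable 1 (ae_of_all _ fun y => by
      rw [Real.norm_of_nonneg (hr0 w y).le]; exact hr1 w y)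
  have hli : ∀ w, Integrable (fun y => -Real.log (r w y)) (P w) := fun w => by
    refine Integrable.of_bound (hm w).log.neg.aestronglyMeasurable (-Real.log δ)
      (ae_of_all _ fun y => ?_)
    rw [Real.norm_of_nonneg (neg_nonneg.2 (Real.log_nonpos (hr0 w y).le (hr1 w y)))]
    exact neg_le_neg (Real.log_le_log hδ (hr w y))
  have h1 : ∀ w, Real.log N - c + 1 - N * ∫ y, r w y ∂Q ≤ ∫ y, -Real.log (r w y) ∂(P w) := by
    intro w
    have h2 : ∫ y, r w y ∂(P w) ≤ Real.exp c * ∫ y, r w y ∂Q := by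
      have h3 := integral_mono_measure (hdom w) (ae_of_all _ fun y => (hr0 w y).le)
        ((hri w Q).smul_measure ENNReal.ofReal_ne_top)
      rwa [integral_smul_measure, ENNReal.toReal_ofReal (Real.exp_nonneg _), smul_eq_mul] at h3
    have h4 : ∫ y, (Real.log N - c + 1 - N * Real.exp (-c) * r w y) ∂(P w) ≤
        ∫ y, -Real.log (r w y) ∂(P w) := by
      refine integral_mono ((integrable_const _).sub ((hri w (P w)).const_mul _)) (hli w) fun y => ?_
      -- This scaling makes the linear terms cancel after domination by `exp c • Q` and summation
      -- over `w`, since `∑ w, r w y ≤ 1`.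
      have h5 := Real.log_le_sub_one_of_pos (x := N * Real.exp (-c) * r w y)
        (by have := hr0 w y; positivity)
      rw [Real.log_mul (by positivity) (hr0 w y).ne', Real.log_mul hN.ne' (Real.exp_ne_zero _),
        Real.log_exp] at h5
      simp only
      linarith
    rw [integral_sub (integrable_const _) ((hri w (P w)).const_mul _), integral_const,
      integral_const_mul] at h4
    simp only [probReal_univ, one_smul] at h4
    have h6 : N * Real.exp (-c) * ∫ y, r w y ∂(P w) ≤ N * ∫ y, r w y ∂Q := by
      calc N * Real.exp (-c) * ∫ y, r w y ∂(P w)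
          ≤ N * Real.exp (-c) * (Real.exp c * ∫ y, r w y ∂Q) := by gcongr
        _ = N * (Real.exp (-c) * Real.exp c) * ∫ y, r w y ∂Q := by ring
        _ = N * ∫ y, r w y ∂Q := by rw [← Real.exp_add]; simp
    linarith
  have h7 : ∑ w, ∫ y, r w y ∂Q ≤ 1 := by
    rw [← integral_finsetSum _ fun w _ => hri w Q]
    calc _ ≤ ∫ _, (1 : ℝ) ∂Q :=
          integral_mono (integrable_finsetSum _ fun w _ => hri w Q) (integrable_const _) hsum
      _ = 1 := by simp
  rw [le_div_iff₀ hN]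
  have h8 := Finset.sum_le_sum fun w (_ : w ∈ Finset.univ) => h1 w
  rw [Finset.sum_sub_distrib, Finset.sum_const, Finset.card_univ, nsmul_eq_mul,
    ← Finset.mul_sum] at h8
  have h9 : N * ∑ w, ∫ y, r w y ∂Q ≤ N * 1 := by gcongr
  linarith

/-! ### Adaptive descriptions and their weights -/

/-- `Codes r R` says that the weights `r` are those of a sub-probability distribution on the values
of some function on `Ω` that determines `w` up to the relation `R`. -/
def Codes {Ω : Type} (r : Ω → ℝ≥0∞) (R : Ω → Ω → Prop) : Prop :=
  ∃ (α : Type) (X : Ω → α) (p : α → ℝ≥0∞), ∑' x, p x ≤ 1 ∧ (∀ w, r w = p (X w)) ∧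
    ∀ w w', X w = X w' → R w w'

namespace Codes

variable {Ω : Type} {r : Ω → ℝ≥0∞} {R R' : Ω → Ω → Prop}

theorem mono (h : Codes r R) (hR : ∀ w w', R w w' → R' w w') : Codes r R' :=
  let ⟨α, X, p, h1, h2, h3⟩ := h
  ⟨α, X, p, h1, h2, fun w w' e => hR w w' (h3 w w' e)⟩

theorem one : Codes (fun _ : Ω => 1) fun _ _ => True :=
  ⟨Unit, fun _ => (), fun _ => 1, by simp, fun _ => rfl, fun _ _ _ => trivial⟩

/-- Describing one more function `e` of `w`, with weights that depend on what is known already. -/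
theorem extend {β : Type} (h : Codes r R) (p : Ω → β → ℝ≥0∞) (hp : ∀ w, ∑' b, p w b ≤ 1)
    (hpR : ∀ w w', R w w' → p w = p w') (e : Ω → β) :
    Codes (fun w => r w * p w (e w)) fun w w' => R w w' ∧ e w = e w' := by
  classical
  obtain ⟨α, X, q, h1, h2, h3⟩ := h
  -- The choice of representative is immaterial by `hpR`; values outside the range of `X` get weight
  -- zero.
  let p' : α → β → ℝ≥0∞ := fun x => if hx : ∃ w, X w = x then p hx.choose else 0
  have hp' : ∀ w, p' (X w) = p w := fun w => by
    have hx : ∃ w', X w' = X w := ⟨w, rfl⟩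
    simp only [p', dif_pos hx]
    exact hpR _ _ (h3 _ _ hx.choose_spec)
  have hs : ∀ x, ∑' b, p' x b ≤ 1 := fun x => by
    by_cases hx : ∃ w, X w = x
    · simp only [p', dif_pos hx]; exact hp _
    · simp [p', dif_neg hx]
  refine ⟨α × β, fun w => (X w, e w), fun z => q z.1 * p' z.1 z.2, ?_, fun w => ?_, fun w w' h => ?_⟩
  · rw [ENNReal.tsum_prod']
    calc ∑' a, ∑' b, q a * p' a b ≤ ∑' a, q a * 1 := by
          refine ENNReal.tsum_le_tsum fun a => ?_
          rw [ENNReal.tsum_mul_left]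
          gcongr
          exact hs a
      _ ≤ 1 := by simpa using h1
  · simp only [hp', h2]
  · simp only [Prod.mk.injEq] at h
    exact ⟨h3 _ _ h.1, h.2⟩

/-- Describing a finite family of functions of `w`, each with fixed weights. -/
theorem extend_finset {ι β : Type} (h : Codes r R) (s : Finset ι) (p : ι → β → ℝ≥0∞)
    (hp : ∀ i, ∑' b, p i b ≤ 1) (e : ι → Ω → β) :
    Codes (fun w => r w * ∏ i ∈ s, p i (e i w)) fun w w' => R w w' ∧ ∀ i ∈ s, e i w = e i w' := by
  classical
  induction s using Finset.induction_on with
  | empty => simpa using h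
  | insert i s hi ih =>
    have := ih.extend (fun _ => p i) (fun _ => hp i) (fun _ _ _ => rfl) (e i)
    simp only [Finset.prod_insert hi]
    have h2 : (fun w => r w * (p i (e i w) * ∏ x ∈ s, p x (e x w))) =
        fun w => (r w * ∏ i ∈ s, p i (e i w)) * p i (e i w) := by
      funext w; ring
    rw [h2]
    refine this.mono fun w w' hw => ⟨hw.1.1, fun j hj => ?_⟩
    rcases Finset.mem_insert.1 hj with rfl | hj
    · exact hw.2
    · exact hw.1.2 j hj

theorem sum_le_one [Fintype Ω] (h : Codes r R) (hR : ∀ w w', R w w' → w = w') :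
    ∑ w, r w ≤ 1 := by
  obtain ⟨α, X, q, h1, h2, h3⟩ := h
  rw [← tsum_fintype (L := .unconditional _)]
  simp only [h2]
  exact (ENNReal.tsum_comp_le_tsum_of_injective (fun w w' e => hR _ _ (h3 _ _ e)) q).trans h1

end Codes

/-! ### Entropy of functions of one file -/

/-- The probability that the function `f` of a uniform file takes the value `v`. -/
noncomputable def fileProb {F : ℕ} {γ : Type} (f : CacheFile F → γ) (v : γ) : ℝ :=
  open Classical in ((Finset.univ.filter fun w => f w = v).card : ℝ) / 2 ^ F

/-- The entropy, in nats, of the function `f` of a uniform file. -/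
noncomputable def fileEntropy {F : ℕ} {γ : Type} (f : CacheFile F → γ) : ℝ :=
  (∑ w, -Real.log (fileProb f (f w))) / 2 ^ F

section Entropy

variable {F : ℕ} {γ : Type} (f : CacheFile F → γ)

theorem fileProb_nonneg (v : γ) : 0 ≤ fileProb f v := by
  unfold fileProb; positivity

theorem inv_le_fileProb (w : CacheFile F) : ((2 : ℝ) ^ F)⁻¹ ≤ fileProb f (f w) := by
  classical
  rw [fileProb, inv_eq_one_div]
  gcongr
  have : 0 < (Finset.univ.filter fun w' => f w' = f w).card :=
    Finset.card_pos.2 ⟨w, by simp⟩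
  exact_mod_cast this

theorem fileProb_pos (w : CacheFile F) : 0 < fileProb f (f w) :=
  lt_of_lt_of_le (by positivity) (inv_le_fileProb f w)

theorem card_cacheFile : Fintype.card (CacheFile F) = 2 ^ F := by simp

theorem fileProb_le_one (v : γ) : fileProb f v ≤ 1 := by
  classical
  rw [fileProb]
  refine div_le_one_of_le₀ ?_ (by positivity)
  have := Finset.card_filter_le (Finset.univ : Finset (CacheFile F)) fun w => f w = v
  rw [Finset.card_univ, card_cacheFile] at this
  exact_mod_cast this

theorem fileEntropy_nonneg : 0 ≤ fileEntropy f := by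
  refine div_nonneg (Finset.sum_nonneg fun w _ => ?_) (by positivity)
  exact neg_nonneg.2 (Real.log_nonpos (fileProb_nonneg _ _) (fileProb_le_one _ _))

theorem tsum_fileProb_le_one : ∑' v, ENNReal.ofReal (fileProb f v) ≤ 1 := by
  classical
  have h1 : ∀ v, ENNReal.ofReal (fileProb f v) =
      ∑ w : CacheFile F, if f w = v then ((2 : ℝ≥0∞) ^ F)⁻¹ else 0 := fun v => by
    rw [← Finset.sum_filter, Finset.sum_const, fileProb, ENNReal.ofReal_div_of_pos (by positivity),
      ENNReal.ofReal_natCast, ENNReal.ofReal_pow zero_le_two, nsmul_eq_mul, div_eq_mul_inv]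
    simp
  simp_rw [h1]
  rw [Summable.tsum_finsetSum fun _ _ => ENNReal.summable]
  have h2 : ∀ w : CacheFile F, ∑' v, (if f w = v then ((2 : ℝ≥0∞) ^ F)⁻¹ else 0) =
      ((2 : ℝ≥0∞) ^ F)⁻¹ := fun w => by
    rw [tsum_eq_single (f w) fun v hv => if_neg hv.symm, if_pos rfl]
  simp only [h2]
  rw [Finset.sum_const, Finset.card_univ, card_cacheFile, nsmul_eq_mul]
  push_cast
  exact ENNReal.mul_inv_le_one _

theorem card_library (L : ℕ) : Fintype.card (Library L F) = (2 ^ F) ^ L := by simp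

theorem sum_library_comp_apply {L : ℕ} (i : Fin L) (g : CacheFile F → ℝ) :
    (∑ W : Library L F, g (W i)) / Fintype.card (Library L F) = (∑ w, g w) / 2 ^ F := by
  classical
  have hc := Fintype.card_congr (Equiv.funSplitAt i (CacheFile F))
  rw [← (Equiv.funSplitAt i (CacheFile F)).symm.sum_comp, Fintype.sum_prod_type]
  simp only [Equiv.funSplitAt_symm_apply, dite_true, Finset.sum_const, Finset.card_univ,
    nsmul_eq_mul, ← Finset.mul_sum]
  rw [hc, Fintype.card_prod, card_cacheFile]
  have hpos : (0 : ℝ) < Fintype.card ({j // j ≠ i} → CacheFile F) := by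
    exact_mod_cast Fintype.card_pos
  push_cast
  rw [mul_comm ((2 : ℝ) ^ F), mul_div_mul_left _ _ hpos.ne']

open Classical in
-- Splitting the term of each value over its fibre turns the entropy into an average over outcomes,
-- the form in which code lengths are averaged.
theorem entropyBits_mul_log {Ω α : Type*} [Fintype Ω] (X : Ω → α) :
    entropyBits X * Real.log 2 =
      ∑ ω, -Real.log (((Finset.univ.filter fun ω' => X ω' = X ω).card : ℝ) / Fintype.card Ω) /
        Fintype.card Ω := by
  rw [entropyBits, ← Finset.sum_div, div_mul_cancel₀ _ (Real.log_pos one_lt_two).ne']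
  refine Finset.sum_image' _ fun ω _ => ?_
  have h : ∀ ω' ∈ Finset.univ.filter fun ω' => X ω' = X ω,
      -Real.log (((Finset.univ.filter fun ω'' => X ω'' = X ω').card : ℝ) / Fintype.card Ω) /
        Fintype.card Ω =
      -Real.log (((Finset.univ.filter fun ω'' => X ω'' = X ω).card : ℝ) / Fintype.card Ω) /
        Fintype.card Ω := fun ω' hω' => by rw [(Finset.mem_filter.1 hω').2]
  rw [Finset.sum_congr rfl h, Finset.sum_const, nsmul_eq_mul, Real.negMulLog]
  ring

/-- Since files are cached separately, each fibre of the cache content is a product of fibres over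
the files: probabilities multiply and entropies add. -/
theorem entropyBits_pi {L : ℕ} (φ : Fin L → CacheFile F → ℕ) :
    entropyBits (fun (W : Library L F) i => φ i (W i)) * Real.log 2 =
      ∑ i, fileEntropy (φ i) := by
  classical
  have hN : (0 : ℝ) < Fintype.card (Library L F) := by exact_mod_cast Fintype.card_pos
  have hprob : ∀ W : Library L F,
      (((Finset.univ.filter fun W' : Library L F =>
        (fun i => φ i (W' i)) = fun i => φ i (W i)).card : ℝ) / Fintype.card (Library L F)) =
      ∏ i, fileProb (φ i) (φ i (W i)) := fun W => by
    have h1 : (Finset.univ.filter fun W' : Library L F =>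
        (fun i => φ i (W' i)) = fun i => φ i (W i)) =
        Fintype.piFinset fun i => Finset.univ.filter fun w => φ i w = φ i (W i) := by
      ext W'
      simp [funext_iff]
    rw [h1, Fintype.card_piFinset, card_library]
    simp only [fileProb, Finset.prod_div_distrib, Finset.prod_const, Finset.card_univ,
      Fintype.card_fin]
    push_cast
    congr!
  rw [entropyBits_mul_log]
  have h2 : ∀ W : Library L F, -Real.log (((Finset.univ.filter fun W' : Library L F =>
        (fun i => φ i (W' i)) = fun i => φ i (W i)).card : ℝ) / Fintype.card (Library L F)) =
      -Real.log (∏ i, fileProb (φ i) (φ i (W i))) := fun W => by rw [hprob W]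
  refine (Finset.sum_congr rfl fun W _ => congrArg (· / (Fintype.card (Library L F) : ℝ))
    (Eq.trans (by congr!) (h2 W))).trans ?_
  have h5 : ∀ W : Library L F, -Real.log (∏ i, fileProb (φ i) (φ i (W i))) =
      ∑ i, -Real.log (fileProb (φ i) (φ i (W i))) := fun W => by
    rw [Real.log_prod fun i _ => (fileProb_pos _ _).ne', Finset.sum_neg_distrib]
  simp only [h5]
  rw [← Finset.sum_div, Finset.sum_comm, Finset.sum_div]
  exact Finset.sum_congr rfl fun i _ =>
    sum_library_comp_apply i fun w => -Real.log (fileProb (φ i) (φ i w))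

/-- The entropy of the bits in a set of positions. -/
theorem fileEntropy_eq_card (A : Finset (Fin F))
    (hA : ∀ w w' : CacheFile F, f w = f w' ↔ ∀ b ∈ A, w b = w' b) :
    fileEntropy f = A.card * Real.log 2 := by
  classical
  have h1 : ∀ w, fileProb f (f w) = ((2 : ℝ) ^ A.card)⁻¹ := fun w => by
    have h2 : (Finset.univ.filter fun w' => f w' = f w) =
        Fintype.piFinset fun b => if b ∈ A then {w b} else Finset.univ := by
      ext w'
      simp only [Finset.mem_filter, Finset.mem_univ, true_and, hA, Fintype.mem_piFinset]
      refine forall_congr' fun b => ?_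
      by_cases hb : b ∈ A <;> simp [hb]
    have h3 : (Finset.univ.filter fun w' => f w' = f w).card * 2 ^ A.card = 2 ^ F := by
      rw [h2, Fintype.card_piFinset]
      have h4 : ∀ b, (if b ∈ A then ({w b} : Finset Bool) else Finset.univ).card =
          if b ∈ A then 1 else 2 := fun b => by split_ifs <;> simp
      simp only [h4]
      rw [Finset.prod_ite, Finset.prod_const_one, one_mul, Finset.prod_const, ← pow_add]
      congr 1
      have := Finset.card_filter_add_card_filter_not (s := (Finset.univ : Finset (Fin F))) (· ∈ A)
      rw [Finset.card_univ, Fintype.card_fin, Finset.filter_mem_eq_inter, Finset.univ_inter] at this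
      omega
    rw [fileProb, div_eq_iff (by positivity), eq_comm, inv_mul_eq_div, div_eq_iff (by positivity)]
    exact_mod_cast (by convert h3.symm)
  simp only [fileEntropy, h1, Real.log_inv, Real.log_pow, neg_neg, Finset.sum_const,
    Finset.card_univ, card_cacheFile, nsmul_eq_mul]
  push_cast
  field_simp

theorem fileEntropy_const (v : γ) : fileEntropy (fun _ : CacheFile F => v) = 0 := by
  rw [fileEntropy_eq_card _ ∅ (by simp)]; simp

end Entropy

/-! ### The converse for one code -/

/-- The channel matrix `M` of one slot is reducible with bound `K` if every output is a combination,
with coefficients of squared modulus at most `K`, of the outputs of the first `l` receivers and of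
the inputs of all but the first `l` transmitters. -/
def Reducible {NT NR : ℕ} (l : ℕ) (K : ℝ) (M : Fin NR → Fin NT → ℂ) : Prop :=
  ∃ (a : Fin NR → Fin NR → ℂ) (b : Fin NR → Fin NT → ℂ), (∀ q q', ‖a q q'‖ ^ 2 ≤ K) ∧
    (∀ q q' : Fin NR, l ≤ (q' : ℕ) → a q q' = 0) ∧ (∀ q, ∀ p : Fin NT, (p : ℕ) < l → b q p = 0) ∧
    ∀ q p, M q p = ∑ q', a q q' * M q' p + b q p

/-- The probability with which a file is predicted to be `b` when the guess is `g`. -/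
noncomputable def guessWeight {F : ℕ} (g b : CacheFile F) : ℝ :=
  if g = b then 1 / 2 else 1 / 2 * ((2 : ℝ) ^ F)⁻¹

theorem guessWeight_pos {F : ℕ} (g b : CacheFile F) : 0 < guessWeight g b := by
  unfold guessWeight; split_ifs <;> positivity

theorem le_guessWeight {F : ℕ} (g b : CacheFile F) : 1 / 2 * ((2 : ℝ) ^ F)⁻¹ ≤ guessWeight g b := by
  unfold guessWeight
  split_ifs
  · have : ((2 : ℝ) ^ F)⁻¹ ≤ 1 := inv_le_one_of_one_le₀ (one_le_pow₀ one_le_two)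
    linarith
  · exact le_rfl

theorem tsum_guessWeight_le_one {F : ℕ} (g : CacheFile F) :
    ∑' b, ENNReal.ofReal (guessWeight g b) ≤ 1 := by
  rw [tsum_fintype, ← ENNReal.ofReal_sum_of_nonneg fun b _ => (guessWeight_pos g b).le]
  refine ENNReal.ofReal_le_one.2 ?_
  have h : ∀ b, guessWeight g b ≤
      (if g = b then 1 / 2 else 0) + 1 / 2 * ((2 : ℝ) ^ F)⁻¹ := fun b => by
    unfold guessWeight
    split_ifs
    · have : 0 < ((2 : ℝ) ^ F)⁻¹ := by positivity
      linarith
    · simp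
  refine (Finset.sum_le_sum fun b _ => h b).trans ?_
  rw [Finset.sum_add_distrib, Finset.sum_ite_eq, if_pos (Finset.mem_univ _), Finset.sum_const,
    Finset.card_univ, card_cacheFile, nsmul_eq_mul]
  push_cast
  have : (2 : ℝ) ^ F ≠ 0 := by positivity
  field_simp
  norm_num

/-- Fano's inequality as a code length: one bit always, and the `F` bits of the file when the guess
is wrong. -/
theorem neg_log_guessWeight {F : ℕ} (g b : CacheFile F) :
    -Real.log (guessWeight g b) = Real.log 2 + if g = b then 0 else F * Real.log 2 := by
  unfold guessWeight
  split_ifs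
  · simp [Real.log_inv]
  · rw [Real.log_mul (by norm_num) (by positivity), Real.log_inv, Real.log_pow]
    simp only [one_div, Real.log_inv]
    ring

/-! ### Successive decoding from side information -/

namespace CachingCode

variable {NT NR L F : ℕ} {MT MR P : ℝ} (C : CachingCode NT NR L F MT MR P)

/-- The noiseless signal at receiver `q`. -/
noncomputable def noiseless (q : Fin NR) (W : Library L F) (d : Fin NR → Fin L)
    (H : Channel NT NR) (t : Fin (C.T d H)) : ℂ :=
  ∑ p, H t q p * C.codeword p W d H t

/-- The signal at receiver `q`, reconstructed from the pair `y` of the outputs `y.1` at the first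
`l` receivers and the residuals `y.2`. -/
noncomputable def reconstructed (l : ℕ) {d : Fin NR → Fin L} {H : Channel NT NR}
    (a : Fin (C.T d H) → Fin NR → Fin NR → ℂ) (b : Fin (C.T d H) → Fin NR → Fin NT → ℂ)
    (q : Fin NR) (W : Library L F)
    (y : (Fin NR → Fin (C.T d H) → ℂ) × (Fin NR → Fin (C.T d H) → ℂ)) : Fin (C.T d H) → ℂ :=
  if (q : ℕ) < l then y.1 q
  else fun t => y.2 q t + ∑ q', a t q q' * y.1 q' t + ∑ p, b t q p * C.codeword p W d H t

theorem measurable_reconstructed (l : ℕ) {d : Fin NR → Fin L} {H : Channel NT NR}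
    (a : Fin (C.T d H) → Fin NR → Fin NR → ℂ) (b : Fin (C.T d H) → Fin NR → Fin NT → ℂ)
    (q : Fin NR) (W : Library L F) : Measurable (C.reconstructed l a b q W) := by
  unfold reconstructed
  split_ifs
  · fun_prop
  · fun_prop

/-- The estimate of receiver `q` from the reconstructed signal. -/
noncomputable def estimate (l : ℕ) {d : Fin NR → Fin L} {H : Channel NT NR}
    (a : Fin (C.T d H) → Fin NR → Fin NR → ℂ) (b : Fin (C.T d H) → Fin NR → Fin NT → ℂ)
    (q : Fin NR) (W : Library L F)
    (y : (Fin NR → Fin (C.T d H) → ℂ) × (Fin NR → Fin (C.T d H) → ℂ)) : CacheFile F :=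
  C.Γ q (fun i => C.ψ q i (W i)) d H (C.reconstructed l a b q W y)

theorem measurable_estimate (l : ℕ) {d : Fin NR → Fin L} {H : Channel NT NR}
    (a : Fin (C.T d H) → Fin NR → Fin NR → ℂ) (b : Fin (C.T d H) → Fin NR → Fin NT → ℂ)
    (q : Fin NR) (W : Library L F) : Measurable (C.estimate l a b q W) :=
  (C.measurable_Γ _ _ _ _).comp (C.measurable_reconstructed l a b q W)

/-- The weight with which the side information about `W` is described: the files that nobody
requests, the common parts `c`, the remaining parts `e` of the receiver caches and the contents of
the caches of all but the first `l` transmitters. -/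
noncomputable def sideWeight {γ : Type} (l : ℕ) (d : Fin NR → Fin L) (R : Finset (Fin NR))
    (c : Fin L → CacheFile F → γ) (e : Fin NR → Fin L → CacheFile F → γ) (W : Library L F) : ℝ :=
  (∏ _i ∈ Finset.univ \ R.image d, ((2 : ℝ) ^ F)⁻¹) *
    (∏ q ∈ R, fileProb (c (d q)) (c (d q) (W (d q)))) *
    (∏ x ∈ (R ×ˢ R).filter (fun x => x.1 ≤ x.2),
      fileProb (e x.1 (d x.2)) (e x.1 (d x.2) (W (d x.2)))) *
    (∏ x ∈ (Finset.univ ×ˢ R).filter (fun x : Fin NT × Fin NR => l ≤ (x.1 : ℕ) ∧ l ≤ (x.2 : ℕ)),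
      fileProb (C.φ x.1 (d x.2)) (C.φ x.1 (d x.2) (W (d x.2))))

theorem sideWeight_pos {γ : Type} (l : ℕ) (d : Fin NR → Fin L) (R : Finset (Fin NR))
    (c : Fin L → CacheFile F → γ) (e : Fin NR → Fin L → CacheFile F → γ) (W : Library L F) :
    0 < C.sideWeight l d R c e W := by
  unfold sideWeight
  have h : ∀ {γ : Type} (f : CacheFile F → γ) w, 0 < fileProb f (f w) := fun f w => fileProb_pos f w
  exact mul_pos (mul_pos (mul_pos (Finset.prod_pos fun _ _ => by positivity)
    (Finset.prod_pos fun _ _ => h _ _)) (Finset.prod_pos fun _ _ => h _ _))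
    (Finset.prod_pos fun _ _ => h _ _)

theorem neg_log_sideWeight {γ : Type} (l : ℕ) {d : Fin NR → Fin L} (hd : Function.Injective d)
    (R : Finset (Fin NR)) (c : Fin L → CacheFile F → γ) (e : Fin NR → Fin L → CacheFile F → γ)
    (W : Library L F) :
    -Real.log (C.sideWeight l d R c e W) = (L - R.card) * F * Real.log 2 +
      (∑ q ∈ R, -Real.log (fileProb (c (d q)) (c (d q) (W (d q))))) +
      (∑ x ∈ (R ×ˢ R).filter (fun x => x.1 ≤ x.2),
        -Real.log (fileProb (e x.1 (d x.2)) (e x.1 (d x.2) (W (d x.2))))) +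
      (∑ x ∈ (Finset.univ ×ˢ R).filter
          (fun x : Fin NT × Fin NR => l ≤ (x.1 : ℕ) ∧ l ≤ (x.2 : ℕ)),
        -Real.log (fileProb (C.φ x.1 (d x.2)) (C.φ x.1 (d x.2) (W (d x.2))))) := by
  have h : ∀ {γ : Type} (f : CacheFile F → γ) w, fileProb f (f w) ≠ 0 :=
    fun f w => (fileProb_pos f w).ne'
  have hp : ∀ {γ : Type} (f : CacheFile F → γ) w, 0 < fileProb f (f w) := fun f w => fileProb_pos f w
  have h1 : ∏ _i ∈ Finset.univ \ R.image d, ((2 : ℝ) ^ F)⁻¹ ≠ 0 :=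
    Finset.prod_ne_zero_iff.2 fun _ _ => by positivity
  have h2 : ∏ q ∈ R, fileProb (c (d q)) (c (d q) (W (d q))) ≠ 0 :=
    Finset.prod_ne_zero_iff.2 fun _ _ => h _ _
  have h3 : ∏ x ∈ (R ×ˢ R).filter (fun x => x.1 ≤ x.2),
      fileProb (e x.1 (d x.2)) (e x.1 (d x.2) (W (d x.2))) ≠ 0 :=
    Finset.prod_ne_zero_iff.2 fun _ _ => h _ _
  have h4 : ∏ x ∈ (Finset.univ ×ˢ R).filter
      (fun x : Fin NT × Fin NR => l ≤ (x.1 : ℕ) ∧ l ≤ (x.2 : ℕ)),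
      fileProb (C.φ x.1 (d x.2)) (C.φ x.1 (d x.2) (W (d x.2))) ≠ 0 :=
    Finset.prod_ne_zero_iff.2 fun _ _ => h _ _
  rw [sideWeight, Real.log_mul (mul_ne_zero (mul_ne_zero h1 h2) h3) h4,
    Real.log_mul (mul_ne_zero h1 h2) h3, Real.log_mul h1 h2,
    Real.log_prod (fun _ _ => h _ _), Real.log_prod (fun _ _ => h _ _),
    Real.log_prod (fun _ _ => h _ _), Real.log_prod (fun _ _ => by positivity)]
  simp only [Finset.sum_neg_distrib, Finset.sum_const, nsmul_eq_mul, Real.log_inv, Real.log_pow]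
  have hcard : ((Finset.univ \ R.image d).card : ℝ) = L - R.card := by
    rw [Finset.card_sdiff_of_subset (Finset.subset_univ _), Finset.card_univ, Fintype.card_fin,
      Finset.card_image_of_injective _ hd, Nat.cast_sub]
    have := Finset.card_le_univ (R.image d)
    rwa [Finset.card_image_of_injective _ hd, Fintype.card_fin] at this
  rw [hcard]
  ring

/-- For every observation, the side information together with the successive guesses of the
requested files describes the library. -/
theorem sum_sideWeight_mul_guessWeight_le_one {γ : Type} {l : ℕ} {d : Fin NR → Fin L}
    {H : Channel NT NR} {a : Fin (C.T d H) → Fin NR → Fin NR → ℂ}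
    {b : Fin (C.T d H) → Fin NR → Fin NT → ℂ}
    (hb : ∀ t q, ∀ p : Fin NT, (p : ℕ) < l → b t q p = 0) (R : Finset (Fin NR))
    {c : Fin L → CacheFile F → γ} {e : Fin NR → Fin L → CacheFile F → γ}
    (hce : ∀ q i w w', c i w = c i w' → e q i w = e q i w' → C.ψ q i w = C.ψ q i w')
    (y : (Fin NR → Fin (C.T d H) → ℂ) × (Fin NR → Fin (C.T d H) → ℂ)) :
    ∑ W, C.sideWeight l d R c e W *
      ∏ q ∈ R, guessWeight (C.estimate l a b q W y) (W (d q)) ≤ 1 := by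
  classical
  let side : Library L F → Library L F → Prop := fun W W' =>
    (∀ i ∈ Finset.univ \ R.image d, W i = W' i) ∧
    (∀ q ∈ R, c (d q) (W (d q)) = c (d q) (W' (d q))) ∧
    (∀ x ∈ (R ×ˢ R).filter (fun x => x.1 ≤ x.2),
      e x.1 (d x.2) (W (d x.2)) = e x.1 (d x.2) (W' (d x.2))) ∧
    (∀ x ∈ (Finset.univ ×ˢ R).filter
      (fun x : Fin NT × Fin NR => l ≤ (x.1 : ℕ) ∧ l ≤ (x.2 : ℕ)),
      C.φ x.1 (d x.2) (W (d x.2)) = C.φ x.1 (d x.2) (W' (d x.2)))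
  have h0 : Codes (fun W => ENNReal.ofReal (C.sideWeight l d R c e W)) side := by
    have h1 := Codes.one (Ω := Library L F)
    have h2 := h1.extend_finset (β := CacheFile F) (Finset.univ \ R.image d)
      (fun _ _ => ENNReal.ofReal ((2 : ℝ) ^ F)⁻¹) (fun _ => by
        rw [tsum_fintype, Finset.sum_const, Finset.card_univ, card_cacheFile,
          nsmul_eq_mul, ENNReal.ofReal_inv_of_pos (by positivity),
          ENNReal.ofReal_pow zero_le_two, ENNReal.ofReal_ofNat]
        push_cast
        exact ENNReal.mul_inv_le_one _) (fun i W => W i)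
    have h3 := h2.extend_finset R (fun q v => ENNReal.ofReal (fileProb (c (d q)) v))
      (fun q => tsum_fileProb_le_one _) (fun q W => c (d q) (W (d q)))
    have h4 := h3.extend_finset ((R ×ˢ R).filter (fun x => x.1 ≤ x.2))
      (fun x v => ENNReal.ofReal (fileProb (e x.1 (d x.2)) v))
      (fun q => tsum_fileProb_le_one _) (fun x W => e x.1 (d x.2) (W (d x.2)))
    have h5 := h4.extend_finset ((Finset.univ ×ˢ R).filter
      (fun x : Fin NT × Fin NR => l ≤ (x.1 : ℕ) ∧ l ≤ (x.2 : ℕ)))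
      (fun x v => ENNReal.ofReal (fileProb (C.φ x.1 (d x.2)) v))
      (fun q => tsum_fileProb_le_one _) (fun x W => C.φ x.1 (d x.2) (W (d x.2)))
    have h6 : Codes _ side := h5.mono fun W W' h => ⟨h.1.1.1.2, h.1.1.2, h.1.2, h.2⟩
    refine (congrArg (fun r => Codes r side) (funext fun W => ?_)).mp h6
    · have hn := @fileProb_nonneg F
      rw [one_mul, sideWeight, ENNReal.ofReal_mul, ENNReal.ofReal_mul, ENNReal.ofReal_mul,
        ENNReal.ofReal_prod_of_nonneg, ENNReal.ofReal_prod_of_nonneg,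
        ENNReal.ofReal_prod_of_nonneg, ENNReal.ofReal_prod_of_nonneg]
      rotate_left 4
      · exact Finset.prod_nonneg fun _ _ => by positivity
      · exact mul_nonneg (Finset.prod_nonneg fun _ _ => by positivity)
          (Finset.prod_nonneg fun _ _ => hn _ _)
      · exact mul_nonneg (mul_nonneg (Finset.prod_nonneg fun _ _ => by positivity)
          (Finset.prod_nonneg fun _ _ => hn _ _)) (Finset.prod_nonneg fun _ _ => hn _ _)
      all_goals intros; first | exact hn _ _ | positivity
  -- Receivers are processed by increasing index. A guess may depend on everything described before
  -- it, and this is what `Codes.extend` allows.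
  have hstep : ∀ n : ℕ, Codes (fun W => ENNReal.ofReal (C.sideWeight l d R c e W) *
      ∏ q ∈ R.filter (fun q : Fin NR => (q : ℕ) < n),
        ENNReal.ofReal (guessWeight (C.estimate l a b q W y) (W (d q))))
      fun W W' => side W W' ∧ ∀ q ∈ R, (q : ℕ) < n → W (d q) = W' (d q) := by
    intro n
    induction n with
    | zero =>
      simpa using h0
    | succ n ih =>
      by_cases hn : ∃ q ∈ R, (q : ℕ) = n
      · obtain ⟨q, hq, rfl⟩ := hn
        have hfil : R.filter (fun q' : Fin NR => (q' : ℕ) < (q : ℕ) + 1) =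
            insert q (R.filter fun q' : Fin NR => (q' : ℕ) < q) := by
          ext q'
          simp only [Finset.mem_filter, Finset.mem_insert, Nat.lt_succ_iff_lt_or_eq, Fin.ext_iff]
          constructor
          · rintro ⟨h1, h2 | h2⟩
            · exact Or.inr ⟨h1, h2⟩
            · exact Or.inl h2
          · rintro (h | h)
            · exact ⟨Fin.ext h ▸ hq, Or.inr h⟩
            · exact ⟨h.1, Or.inl h.2⟩
        have hext := ih.extend
          (fun W b' => ENNReal.ofReal (guessWeight (C.estimate l a b q W y) b'))
          (fun W => tsum_guessWeight_le_one _) (fun W W' hW => by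
            -- At the turn of `q`, a file not yet known is requested by some active `q' ≥ q`. Hence
            -- side information for pairs `q ≤ q'` is enough.
            have hfile : ∀ i, (∃ q' ∈ R, d q' = i ∧ q ≤ q') ∨ W i = W' i := fun i => by
              by_cases hi : ∃ q' ∈ R, d q' = i
              · obtain ⟨q', hq', rfl⟩ := hi
                rcases lt_or_ge q' q with h | h
                · exact Or.inr (hW.2 q' hq' h)
                · exact Or.inl ⟨q', hq', rfl, h⟩
              · exact Or.inr (hW.1.1 i (by simpa using hi))
            have hψ : ∀ i, C.ψ q i (W i) = C.ψ q i (W' i) := fun i => by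
              rcases hfile i with ⟨q', hq', rfl, h⟩ | h
              · exact hce _ _ _ _ (hW.1.2.1 q' hq')
                  (hW.1.2.2.1 (q, q') (by simp [hq, hq', h]))
              · rw [h]
            -- Here `q' ≥ q ≥ l`, so the pair `(p, q')` belongs to the transmitter side information.
            -- Transmitters `p < l` are not needed, as their coefficients `b` vanish.
            have hφ : l ≤ (q : ℕ) → ∀ p : Fin NT, l ≤ (p : ℕ) →
                ∀ i, C.φ p i (W i) = C.φ p i (W' i) := fun hl p hp i => by
              rcases hfile i with ⟨q', hq', rfl, h⟩ | h
              · exact hW.1.2.2.2 (p, q') (by simp [hq', hp, hl.trans h])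
              · rw [h]
            have hrec : C.reconstructed l a b q W y = C.reconstructed l a b q W' y := by
              unfold reconstructed
              split_ifs with hql
              · rfl
              · funext t
                congr 1
                refine Finset.sum_congr rfl fun p _ => ?_
                rcases lt_or_ge (p : ℕ) l with hp | hp
                · rw [hb t q p hp, zero_mul, zero_mul]
                · simp only [codeword, hφ (not_lt.1 hql) p hp]
            simp only [estimate, hψ, hrec]) (fun W => W (d q))
        rw [hfil]
        have hprod : ∀ W : Library L F, ∏ q' ∈ insert q (R.filter fun q' : Fin NR => (q' : ℕ) < q),
            ENNReal.ofReal (guessWeight (C.estimate l a b q' W y) (W (d q'))) =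
            (∏ q' ∈ R.filter fun q' : Fin NR => (q' : ℕ) < q,
              ENNReal.ofReal (guessWeight (C.estimate l a b q' W y) (W (d q')))) *
            ENNReal.ofReal (guessWeight (C.estimate l a b q W y) (W (d q))) := fun W => by
          rw [Finset.prod_insert (by simp), mul_comm]
        simp only [hprod, ← mul_assoc]
        refine hext.mono fun W W' hW => ⟨hW.1.1, fun q' hq' hlt => ?_⟩
        rcases Nat.lt_succ_iff_lt_or_eq.1 hlt with h | h
        · exact hW.1.2 q' hq' h
        · rw [Fin.ext h]; exact hW.2
      · have hfil : R.filter (fun q' : Fin NR => (q' : ℕ) < n + 1) = R.filter fun q' : Fin NR => (q' : ℕ) < n := by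
          refine Finset.filter_congr fun q' hq' => ?_
          have : (q' : ℕ) ≠ n := fun h => hn ⟨q', hq', h⟩
          omega
        rw [hfil]
        refine ih.mono fun W W' hW => ⟨hW.1, fun q' hq' hlt => hW.2 q' hq' ?_⟩
        have : (q' : ℕ) ≠ n := fun h => hn ⟨q', hq', h⟩
        omega
  have hfin := (hstep NR).sum_le_one fun W W' hW => by
    funext i
    by_cases hi : ∃ q' ∈ R, d q' = i
    · obtain ⟨q', hq', rfl⟩ := hi
      exact hW.2 q' hq' q'.2
    · exact hW.1.1 i (by simpa using hi)
  have hfil : R.filter (fun q' : Fin NR => (q' : ℕ) < NR) = R := Finset.filter_true_of_mem fun q _ => q.2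
  rw [hfil] at hfin
  have hpos : ∀ W, 0 ≤ C.sideWeight l d R c e W *
      ∏ q ∈ R, guessWeight (C.estimate l a b q W y) (W (d q)) := fun W =>
    mul_nonneg (C.sideWeight_pos l d R c e W).le
      (Finset.prod_nonneg fun q _ => (guessWeight_pos _ _).le)
  rw [← ENNReal.ofReal_le_one, ENNReal.ofReal_sum_of_nonneg fun W _ => hpos W]
  refine le_trans (le_of_eq (Finset.sum_congr rfl fun W _ => ?_)) hfin
  rw [ENNReal.ofReal_mul (C.sideWeight_pos l d R c e W).le,
    ENNReal.ofReal_prod_of_nonneg fun q _ => (guessWeight_pos _ _).le]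

end CachingCode

/-- Makes one family of coefficients available in all slots. In an irreducible slot `a = b = 0`, so
the residual there is the full output. -/
theorem exists_reduction {NT NR l : ℕ} {K : ℝ} (hK : 0 ≤ K) (M : Fin NR → Fin NT → ℂ) :
    ∃ (a : Fin NR → Fin NR → ℂ) (b : Fin NR → Fin NT → ℂ), (∀ q q', ‖a q q'‖ ^ 2 ≤ K) ∧
      (∀ q q' : Fin NR, l ≤ (q' : ℕ) → a q q' = 0) ∧ (∀ q, ∀ p : Fin NT, (p : ℕ) < l → b q p = 0) ∧
      (Reducible l K M → ∀ q p, M q p = ∑ q', a q q' * M q' p + b q p) ∧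
      (¬ Reducible l K M → ∀ q p, ∑ q', a q q' * M q' p + b q p = 0) := by
  by_cases h : Reducible l K M
  · obtain ⟨a, b, h1, h2, h3, h4⟩ := h
    exact ⟨a, b, h1, h2, h3, fun _ => h4, fun hn => absurd ⟨a, b, h1, h2, h3, h4⟩ hn⟩
  · exact ⟨0, 0, fun _ _ => by simpa using hK, by simp, by simp, fun hn => absurd hn h, by simp⟩

/-! ### Coupling of the receiver noises and the code-length bound -/

namespace CachingCode

variable {NT NR L F : ℕ} {MT MR P : ℝ} (C : CachingCode NT NR L F MT MR P)

open Classical in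
/-- The mean of the output at receiver `q` if `q` is one of the first `l` receivers. -/
noncomputable def outputMean (l : ℕ) (W : Library L F) (d : Fin NR → Fin L) (H : Channel NT NR)
    (q : Fin NR) (t : Fin (C.T d H)) : ℂ :=
  if (q : ℕ) < l then C.noiseless q W d H t else 0

open Classical in
/-- The mean of the residual at receiver `q`, which vanishes in the reducible slots. -/
noncomputable def residualMean (l : ℕ) (K : ℝ) (W : Library L F) (d : Fin NR → Fin L)
    (H : Channel NT NR) (q : Fin NR) (t : Fin (C.T d H)) : ℂ :=
  if Reducible l K (H t) then 0 else C.noiseless q W d H t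

/-- The outputs and residuals as functions of two independent copies of the noise. -/
noncomputable def observation (l : ℕ) (K : ℝ) (W : Library L F) (d : Fin NR → Fin L)
    (H : Channel NT NR) (a : Fin (C.T d H) → Fin NR → Fin NR → ℂ)
    (z : (Fin NR → Fin (C.T d H) → ℂ) × (Fin NR → Fin (C.T d H) → ℂ)) :
    (Fin NR → Fin (C.T d H) → ℂ) × (Fin NR → Fin (C.T d H) → ℂ) :=
  (C.outputMean l W d H + z.1,
    C.residualMean l K W d H - (fun q t => ∑ q', a t q q' * z.1 q' t) + z.2)

theorem measurable_observation (l : ℕ) (K : ℝ) (W : Library L F) (d : Fin NR → Fin L)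
    (H : Channel NT NR) (a : Fin (C.T d H) → Fin NR → Fin NR → ℂ) :
    Measurable (C.observation l K W d H a) := by
  unfold observation
  fun_prop

/-- The shear in `observation` cancels exactly the noise of the first `l` outputs that the
reconstruction adds. A receiver `q ≥ l` is left with its true noiseless signal plus the fresh noise
`z.2 q`. -/
theorem estimate_observation {l : ℕ} {K : ℝ} {d : Fin NR → Fin L} {H : Channel NT NR}
    {a : Fin (C.T d H) → Fin NR → Fin NR → ℂ} {b : Fin (C.T d H) → Fin NR → Fin NT → ℂ}
    (ha : ∀ t q, ∀ q' : Fin NR, l ≤ (q' : ℕ) → a t q q' = 0)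
    (h1 : ∀ t : Fin (C.T d H), Reducible l K (H t) →
      ∀ q p, H t q p = ∑ q', a t q q' * H t q' p + b t q p)
    (h0 : ∀ t : Fin (C.T d H), ¬ Reducible l K (H t) →
      ∀ q p, ∑ q', a t q q' * H t q' p + b t q p = 0)
    (q : Fin NR) (W : Library L F)
    (z : (Fin NR → Fin (C.T d H) → ℂ) × (Fin NR → Fin (C.T d H) → ℂ)) :
    C.estimate l a b q W (C.observation l K W d H a z) =
      C.decoded q W d H (if (q : ℕ) < l then z.1 q else z.2 q) := by
  unfold estimate decoded
  congr 1
  unfold reconstructed observation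
  split_ifs with hq
  · funext t
    simp [outputMean, hq, received, noiseless]
  · funext t
    -- Means set to zero for receivers `q' ≥ l` do no harm: `a` vanishes there.
    have e1 : ∀ q', a t q q' * C.outputMean l W d H q' t = a t q q' * C.noiseless q' W d H t := by
      intro q'
      unfold outputMean
      split_ifs with hq'
      · rfl
      · rw [ha t q q' (not_lt.1 hq')]; simp
    have e2 : C.residualMean l K W d H q t + ∑ q', a t q q' * C.noiseless q' W d H t +
        ∑ p, b t q p * C.codeword p W d H t = C.noiseless q W d H t := by
      have e3 : ∑ q', a t q q' * C.noiseless q' W d H t +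
          ∑ p, b t q p * C.codeword p W d H t =
          ∑ p, (∑ q', a t q q' * H t q' p + b t q p) * C.codeword p W d H t := by
        simp only [noiseless, Finset.mul_sum, add_mul, Finset.sum_add_distrib, Finset.sum_mul]
        rw [Finset.sum_comm]
        simp only [mul_assoc]
      rw [add_assoc, e3]
      unfold residualMean
      split_ifs with hr
      · simp only [← h1 t hr, zero_add, noiseless]
      · simp only [h0 t hr, zero_mul, Finset.sum_const_zero, add_zero]
    simp only [Pi.add_apply, Pi.sub_apply, mul_add, Finset.sum_add_distrib, e1, received]
    change _ = C.noiseless q W d H t + z.2 q t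
    rw [← e2]
    ring

/-- The error event of `q` involves one noise marginal only, so the artificial coupling of `z.1` and
`z.2` leaves every error probability unchanged. -/
theorem noise_decoded_ne {l : ℕ} {K : ℝ} {d : Fin NR → Fin L} {H : Channel NT NR}
    {a : Fin (C.T d H) → Fin NR → Fin NR → ℂ} {b : Fin (C.T d H) → Fin NR → Fin NT → ℂ}
    (ha : ∀ t q, ∀ q' : Fin NR, l ≤ (q' : ℕ) → a t q q' = 0)
    (h1 : ∀ t : Fin (C.T d H), Reducible l K (H t) →
      ∀ q p, H t q p = ∑ q', a t q q' * H t q' p + b t q p)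
    (h0 : ∀ t : Fin (C.T d H), ¬ Reducible l K (H t) →
      ∀ q p, ∑ q', a t q q' * H t q' p + b t q p = 0)
    (q : Fin NR) (W : Library L F) :
    (((Measure.pi fun _ : Fin NR => noiseLaw (C.T d H)).prod
      (Measure.pi fun _ : Fin NR => noiseLaw (C.T d H))).map (C.observation l K W d H a))
        {y | C.estimate l a b q W y ≠ W (d q)} =
      noiseLaw (C.T d H) {z | C.decoded q W d H z ≠ W (d q)} := by
  have hrec : ∀ z, C.received q W d H z = fun t => C.noiseless q W d H t + z t := fun z => rfl
  have hdec : MeasurableSet {z | C.decoded q W d H z ≠ W (d q)} := by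
    have : Measurable (C.decoded q W d H) := by
      refine (C.measurable_Γ _ _ _ _).comp ?_
      rw [show C.received q W d H = _ from funext hrec]
      fun_prop
    exact this (MeasurableSet.singleton (W (d q))).compl
  have hest : MeasurableSet {y | C.estimate l a b q W y ≠ W (d q)} :=
    C.measurable_estimate l a b q W (MeasurableSet.singleton (W (d q))).compl
  rw [Measure.map_apply (C.measurable_observation l K W d H a) hest]
  simp only [Set.preimage_ofPred_eq, C.estimate_observation ha h1 h0]
  split_ifs
  · have hmp := (measurePreserving_eval (fun _ : Fin NR => noiseLaw (C.T d H)) q).comp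
      (measurePreserving_fst (μ := Measure.pi fun _ : Fin NR => noiseLaw (C.T d H))
        (ν := Measure.pi fun _ : Fin NR => noiseLaw (C.T d H)))
    exact hmp.measure_preimage hdec.nullMeasurableSet
  · have hmp := (measurePreserving_eval (fun _ : Fin NR => noiseLaw (C.T d H)) q).comp
      (measurePreserving_snd (μ := Measure.pi fun _ : Fin NR => noiseLaw (C.T d H))
        (ν := Measure.pi fun _ : Fin NR => noiseLaw (C.T d H)))
    exact hmp.measure_preimage hdec.nullMeasurableSet

theorem toReal_errorProb (d : Fin NR → Fin L) (q : Fin NR) (H : Channel NT NR) :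
    (C.errorProb d q H).toReal =
      (∑ W : Library L F, (noiseLaw (C.T d H)).real {z | C.decoded q W d H z ≠ W (d q)}) /
        Fintype.card (Library L F) := by
  rw [errorProb, ENNReal.toReal_div, ENNReal.toReal_sum fun _ _ => measure_ne_top _ _]
  rfl

/-- The converse for one code in terms of a bound `E` on the information that the first `l`
outputs and all residuals carry. -/
theorem card_mul_le_of_dominationExponent_le {γ : Type} {l : ℕ} {K κ E : ℝ} (hK : 0 ≤ K)
    (hκ : 4 * (NR ^ 2 * K + 1) ≤ κ)
    {d : Fin NR → Fin L} (hd : Function.Injective d) (H : Channel NT NR) (R : Finset (Fin NR))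
    {c : Fin L → CacheFile F → γ} {e : Fin NR → Fin L → CacheFile F → γ}
    (hce : ∀ q i w w', c i w = c i w' → e q i w = e q i w' → C.ψ q i w = C.ψ q i w')
    {B B' : Fin NR → Fin (C.T d H) → ℝ} (hB : ∀ q t, 0 ≤ B q t) (hB' : ∀ q t, 0 ≤ B' q t)
    (hx : ∀ W q t, B q t = 0 → C.outputMean l W d H q t = 0)
    (hξ : ∀ W q t, B' q t = 0 → C.residualMean l K W d H q t = 0)
    (hE : ∀ W, dominationExponent κ B B' (C.outputMean l W d H) (C.residualMean l K W d H) ≤ E) :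
    R.card * F * Real.log 2 ≤ E + ∑ q ∈ R, fileEntropy (c (d q)) +
      (∑ x ∈ (R ×ˢ R).filter (fun x => x.1 ≤ x.2), fileEntropy (e x.1 (d x.2))) +
      (∑ x ∈ (Finset.univ ×ˢ R).filter
        (fun x : Fin NT × Fin NR => l ≤ (x.1 : ℕ) ∧ l ≤ (x.2 : ℕ)),
        fileEntropy (C.φ x.1 (d x.2))) +
      ∑ q ∈ R, (Real.log 2 + (C.errorProb d q H).toReal * (F * Real.log 2)) := by
  classical
  choose a b ha2 hal hbl h1 h0 using
    fun t : Fin (C.T d H) => exists_reduction (l := l) hK (H t)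
  obtain ⟨Q, hQ, hdom⟩ := map_shear_noiseLaw_le ha2 hκ hK hB hB'
  let μ : Library L F → Measure _ := fun W =>
    ((Measure.pi fun _ : Fin NR => noiseLaw (C.T d H)).prod
      (Measure.pi fun _ : Fin NR => noiseLaw (C.T d H))).map (C.observation l K W d H a)
  have hμ : ∀ W, IsProbabilityMeasure (μ W) := fun W =>
    Measure.isProbabilityMeasure_map (C.measurable_observation l K W d H a).aemeasurable
  have hdom' : ∀ W, μ W ≤ ENNReal.ofReal (Real.exp E) • Q := fun W => by
    refine (hdom _ _ (hx W) (hξ W)).trans ?_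
    refine Measure.le_iff.2 fun s _ => ?_
    simp only [Measure.smul_apply, smul_eq_mul]
    gcongr
    exact hE W
  let r : Library L F → _ → ℝ := fun W y => C.sideWeight l d R c e W *
    ∏ q ∈ R, guessWeight (C.estimate l a b q W y) (W (d q))
  -- Provides a positive lower bound `δ` for the weights, needed only for integrability of the
  -- logarithm; it does not enter the result.
  obtain ⟨W₀, hW₀⟩ := Finite.exists_min fun W => C.sideWeight l d R c e W
  have hmeas : ∀ W q, Measurable fun y => guessWeight (C.estimate l a b q W y) (W (d q)) :=
    fun W q => (measurable_of_finite fun g => guessWeight g (W (d q))).comp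
      (C.measurable_estimate l a b q W)
  have hsw := C.sideWeight_pos l d R c e
  have main := log_card_sub_le_avg_codeLength μ Q hdom' (r := r)
    (δ := C.sideWeight l d R c e W₀ * ∏ q ∈ R, (1 / 2 * ((2 : ℝ) ^ F)⁻¹))
    (mul_pos (hsw _) (Finset.prod_pos fun _ _ => by positivity))
    (fun W y => mul_le_mul (hW₀ W)
      (Finset.prod_le_prod (fun _ _ => by positivity) fun q _ => le_guessWeight _ _)
      (Finset.prod_nonneg fun _ _ => by positivity) (hsw _).le)
    (fun W => (Finset.measurable_prod _ fun q _ => hmeas W q).const_mul _)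
    (C.sum_sideWeight_mul_guessWeight_le_one hbl R hce)
  have hlog : ∀ W y, -Real.log (r W y) = -Real.log (C.sideWeight l d R c e W) +
      ∑ q ∈ R, (Real.log 2 + {y | C.estimate l a b q W y ≠ W (d q)}.indicator
        (fun _ => F * Real.log 2) y) := fun W y => by
    simp only [r]
    rw [Real.log_mul (hsw W).ne' (Finset.prod_ne_zero_iff.2 fun _ _ => (guessWeight_pos _ _).ne'),
      Real.log_prod fun _ _ => (guessWeight_pos _ _).ne', neg_add, ← Finset.sum_neg_distrib]
    congr 1
    refine Finset.sum_congr rfl fun q _ => ?_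
    rw [neg_log_guessWeight]
    simp [Set.indicator_apply, ite_not]
  have hset : ∀ W q, MeasurableSet {y | C.estimate l a b q W y ≠ W (d q)} := fun W q =>
    C.measurable_estimate l a b q W (MeasurableSet.singleton (W (d q))).compl
  have hint : ∀ W, ∫ y, -Real.log (r W y) ∂(μ W) = -Real.log (C.sideWeight l d R c e W) +
      ∑ q ∈ R, (Real.log 2 + (noiseLaw (C.T d H)).real {z | C.decoded q W d H z ≠ W (d q)} *
        (F * Real.log 2)) := fun W => by
    have hi : ∀ q, Integrable ({y | C.estimate l a b q W y ≠ W (d q)}.indicator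
        (fun _ => F * Real.log 2)) (μ W) := fun q =>
      (integrable_const _).indicator (hset W q)
    have hi2 : ∀ q, Integrable (fun y => Real.log 2 +
        {y | C.estimate l a b q W y ≠ W (d q)}.indicator (fun _ => F * Real.log 2) y) (μ W) :=
      fun q => (integrable_const _).add (hi q)
    simp only [hlog]
    rw [integral_add (integrable_const _) (integrable_finsetSum _ fun q _ => hi2 q),
      integral_finsetSum _ fun q _ => hi2 q]
    simp only [integral_const, probReal_univ, one_smul]
    congr 1
    refine Finset.sum_congr rfl fun q _ => ?_
    rw [integral_add (integrable_const _) (hi q), integral_indicator_const _ (hset W q)]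
    have hr : (μ W).real {y | C.estimate l a b q W y ≠ W (d q)} =
        (noiseLaw (C.T d H)).real {z | C.decoded q W d H z ≠ W (d q)} :=
      congrArg ENNReal.toReal (C.noise_decoded_ne hal h1 h0 q W)
    rw [hr]
    simp only [integral_const, probReal_univ, smul_eq_mul, one_mul]
  simp only [hint, C.neg_log_sideWeight l hd] at main
  simp only [Finset.sum_add_distrib, add_div] at main
  have hN : (0 : ℝ) < Fintype.card (Library L F) := by exact_mod_cast Fintype.card_pos
  have hc : ∀ v : ℝ, (∑ _W : Library L F, v) / Fintype.card (Library L F) = v := fun v => by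
    rw [Finset.sum_const, Finset.card_univ, nsmul_eq_mul, mul_div_cancel_left₀ _ hN.ne']
  have hent : ∀ {ι : Type} (s : Finset ι) {δ : Type} (i : ι → Fin L) (f : ι → CacheFile F → δ),
      (∑ W : Library L F, ∑ x ∈ s, -Real.log (fileProb (f x) (f x (W (i x))))) /
        Fintype.card (Library L F) = ∑ x ∈ s, fileEntropy (f x) := fun s _ i f => by
    rw [Finset.sum_comm, Finset.sum_div]
    exact Finset.sum_congr rfl fun x _ =>
      sum_library_comp_apply (i x) fun w => -Real.log (fileProb (f x) (f x w))
  have herr : (∑ W : Library L F, ∑ q ∈ R, (noiseLaw (C.T d H)).real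
      {z | C.decoded q W d H z ≠ W (d q)} * (F * Real.log 2)) / Fintype.card (Library L F) =
      ∑ q ∈ R, (C.errorProb d q H).toReal * (F * Real.log 2) := by
    rw [Finset.sum_comm, Finset.sum_div]
    refine Finset.sum_congr rfl fun q _ => ?_
    rw [toReal_errorProb, ← Finset.sum_mul]
    ring
  rw [hc, hc, herr, hent R d fun q => c (d q), 
    hent _ (fun x : Fin NR × Fin NR => d x.2) fun x => e x.1 (d x.2),
    hent _ (fun x : Fin NT × Fin NR => d x.2) fun x => C.φ x.1 (d x.2), card_library] at main
  push_cast at main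
  -- The library accounts for `L F log 2` and the unrequested files for `(L - |R|) F log 2`; the
  -- difference is the left-hand side.
  rw [Real.log_pow, Real.log_pow] at main
  rw [Finset.sum_add_distrib]
  linarith

end CachingCode

/-! ### The information carried by the outputs -/

/-- One plus the total power gain of the channels to receiver `q` in a slot with matrix `M`. -/
noncomputable def rowGain {NT NR : ℕ} (M : Fin NR → Fin NT → ℂ) (q : Fin NR) : ℝ :=
  1 + ∑ p, ‖M q p‖ ^ 2

theorem one_le_rowGain {NT NR : ℕ} (M : Fin NR → Fin NT → ℂ) (q : Fin NR) : 1 ≤ rowGain M q :=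
  le_add_of_nonneg_right (Finset.sum_nonneg fun _ _ => by positivity)

/-- The sum of the logarithmic gains of a slot with matrix `M`. -/
noncomputable def logGain {NT NR : ℕ} (M : Fin NR → Fin NT → ℂ) : ℝ :=
  ∑ q, Real.log (rowGain M q)

open Classical in
/-- The number of the first `T` slots that are not reducible. -/
noncomputable def irreducibleCount {NT NR : ℕ} (l : ℕ) (K : ℝ) (H : Channel NT NR) (T : ℕ) : ℕ :=
  ((Finset.range T).filter fun t => ¬ Reducible l K (H t)).card

/-- A bound for the information carried by the first `l` outputs and all residuals in `T` slots. -/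
noncomputable def infoBound {NT NR : ℕ} (l : ℕ) (K P : ℝ) (H : Channel NT NR) (T : ℕ) : ℝ :=
  T * (l * Real.log (1 + P) + NR * (Real.log 2 + Real.log (4 * (NR ^ 2 * K + 1))) + 2 * NR * NT) +
    NR * Real.log (1 + P) * irreducibleCount l K H T + 2 * ∑ t ∈ Finset.range T, logGain (H t)

/-- Lets the block length of any single demand be replaced by the worst-case one. -/
theorem infoBound_mono {NT NR : ℕ} {l : ℕ} {K P : ℝ} (hK : 0 ≤ K) (hP : 0 ≤ P)
    (H : Channel NT NR) {T T' : ℕ} (h : T ≤ T') :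
    infoBound l K P H T ≤ infoBound l K P H T' := by
  classical
  unfold infoBound
  have h1 : 0 ≤ Real.log (1 + P) := Real.log_nonneg (by linarith)
  have h2 : 0 ≤ Real.log 2 := Real.log_nonneg one_le_two
  have h3 : 0 ≤ Real.log (4 * (NR ^ 2 * K + 1)) := by
    have : (0 : ℝ) ≤ NR ^ 2 * K := by positivity
    exact Real.log_nonneg (by linarith)
  have h4 : irreducibleCount l K H T ≤ irreducibleCount l K H T' :=
    Finset.card_le_card (Finset.filter_subset_filter _ (Finset.range_subset_range.2 h))
  have h5 : ∑ t ∈ Finset.range T, logGain (H t) ≤ ∑ t ∈ Finset.range T', logGain (H t) :=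
    Finset.sum_le_sum_of_subset_of_nonneg (Finset.range_subset_range.2 h) fun t _ _ =>
      Finset.sum_nonneg fun q _ => Real.log_nonneg (one_le_rowGain _ _)
  gcongr

namespace CachingCode

variable {NT NR L F : ℕ} {MT MR P : ℝ} (C : CachingCode NT NR L F MT MR P)

theorem norm_noiseless_sq_le (q : Fin NR) (W : Library L F) (d : Fin NR → Fin L)
    (H : Channel NT NR) (t : Fin (C.T d H)) :
    ‖C.noiseless q W d H t‖ ^ 2 ≤ rowGain (H t) q * ∑ p, ‖C.codeword p W d H t‖ ^ 2 := by
  calc ‖C.noiseless q W d H t‖ ^ 2 ≤ (∑ p, ‖H t q p‖ * ‖C.codeword p W d H t‖) ^ 2 := by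
        gcongr
        exact (norm_sum_le _ _).trans (le_of_eq (by simp))
    _ ≤ (∑ p, ‖H t q p‖ ^ 2) * ∑ p, ‖C.codeword p W d H t‖ ^ 2 :=
        Finset.sum_mul_sq_le_sq_mul_sq _ _ _
    _ ≤ _ := by
        gcongr
        exact le_add_of_nonneg_left zero_le_one

/-- With `B = P * rowGain`, Cauchy–Schwarz bounds each quadratic term by the total input power of
the slot divided by `P`, and the power constraint bounds its sum over the block by `NT` times the
block length. Terms of order `log P` come only from the first `l` outputs and from irreducible
slots. -/
theorem dominationExponent_le {l : ℕ} {K κ : ℝ} (hP : 0 < P) (hκ : 0 < κ) (d : Fin NR → Fin L)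
    (H : Channel NT NR) (B B' : Fin NR → Fin (C.T d H) → ℝ)
    (hB : ∀ q t, B q t = if (q : ℕ) < l then P * rowGain (H t) q else 0)
    (hB' : ∀ q (t : Fin (C.T d H)), Reducible l K (H t) → B' q t = 0)
    (hB'' : ∀ q (t : Fin (C.T d H)), ¬ Reducible l K (H t) → B' q t = P * rowGain (H t) q) (W : Library L F) :
    dominationExponent κ B B' (C.outputMean l W d H) (C.residualMean l K W d H) ≤
      C.T d H * (l * Real.log (1 + P) + NR * (Real.log 2 + Real.log κ) + 2 * NR * NT) +
        NR * Real.log (1 + P) * irreducibleCount l K H (C.T d H) +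
        2 * ∑ t ∈ Finset.range (C.T d H), logGain (H t) := by
  classical
  have hlogP : 0 ≤ Real.log (1 + P) := Real.log_nonneg (by linarith)
  have hg := fun (t : Fin (C.T d H)) q => one_le_rowGain (H t) q
  have hlg : ∀ (t : Fin (C.T d H)) q, 0 ≤ Real.log (rowGain (H t) q) := fun t q =>
    Real.log_nonneg (hg t q)
  have hlog : ∀ (t : Fin (C.T d H)) q, Real.log (1 + P * rowGain (H t) q) ≤
      Real.log (1 + P) + Real.log (rowGain (H t) q) := fun t q => by
    have := hg t q
    rw [← Real.log_mul (by positivity) (by positivity)]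
    refine Real.log_le_log (by positivity) ?_
    nlinarith
  have hX0 : ∀ t, 0 ≤ (∑ p, ‖C.codeword p W d H t‖ ^ 2) / P := fun t => by positivity
  have hquot : ∀ (t : Fin (C.T d H)) q, ‖C.noiseless q W d H t‖ ^ 2 / (P * rowGain (H t) q) ≤
      (∑ p, ‖C.codeword p W d H t‖ ^ 2) / P := fun t q => by
    have := hg t q
    rw [div_le_div_iff₀ (by positivity) hP]
    calc _ ≤ (rowGain (H t) q * ∑ p, ‖C.codeword p W d H t‖ ^ 2) * P := by
          gcongr; exact C.norm_noiseless_sq_le q W d H t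
      _ = _ := by ring
  have hterm : ∀ (t : Fin (C.T d H)) q,
      Real.log (2 * (1 + B q t)) + Real.log (κ * (1 + B' q t)) +
        ‖C.outputMean l W d H q t‖ ^ 2 / B q t + ‖C.residualMean l K W d H q t‖ ^ 2 / B' q t ≤
      (if (q : ℕ) < l then Real.log (1 + P) else 0) + (Real.log 2 + Real.log κ) +
        2 * ((∑ p, ‖C.codeword p W d H t‖ ^ 2) / P) +
        (if ¬ Reducible l K (H t) then Real.log (1 + P) else 0) +
        2 * Real.log (rowGain (H t) q) := by
    intro t q
    have e1 : Real.log (2 * (1 + B q t)) + ‖C.outputMean l W d H q t‖ ^ 2 / B q t ≤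
        (if (q : ℕ) < l then Real.log (1 + P) else 0) + Real.log 2 +
        (∑ p, ‖C.codeword p W d H t‖ ^ 2) / P + Real.log (rowGain (H t) q) := by
      have := hlog t q
      have := hlg t q
      have := hX0 t
      have := hquot t q
      have := hg t q
      rw [hB]
      unfold outputMean
      split_ifs
      · rw [Real.log_mul two_ne_zero (by positivity)]
        linarith
      · simp
        linarith
    have e2 : Real.log (κ * (1 + B' q t)) + ‖C.residualMean l K W d H q t‖ ^ 2 / B' q t ≤
        (if ¬ Reducible l K (H t) then Real.log (1 + P) else 0) + Real.log κ +
        (∑ p, ‖C.codeword p W d H t‖ ^ 2) / P + Real.log (rowGain (H t) q) := by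
      have := hlog t q
      have := hlg t q
      have := hX0 t
      have := hquot t q
      have := hg t q
      unfold residualMean
      by_cases hr : Reducible l K (H t)
      · rw [hB' q t hr, if_pos hr, if_neg (not_not.2 hr)]
        simp
        linarith
      · rw [hB'' q t hr, if_neg hr, if_pos hr, Real.log_mul hκ.ne' (by positivity)]
        linarith
    linarith
  refine (Finset.sum_le_sum fun t _ => Finset.sum_le_sum fun q _ => hterm t q).trans ?_
  simp only [Finset.sum_add_distrib]
  have s1 : ∑ _t : Fin (C.T d H), ∑ q : Fin NR, (if (q : ℕ) < l then Real.log (1 + P) else 0) ≤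
      C.T d H * (l * Real.log (1 + P)) := by
    rw [Finset.sum_const, Finset.card_univ, Fintype.card_fin, nsmul_eq_mul]
    gcongr
    rw [← Finset.sum_filter, Finset.sum_const, nsmul_eq_mul]
    gcongr
    have : (Finset.univ.filter fun q : Fin NR => (q : ℕ) < l).card ≤ (Finset.range l).card :=
      Finset.card_le_card_of_injOn (fun q => (q : ℕ)) (fun q hq => by simpa using hq)
        (fun _ _ _ _ h => Fin.ext h)
    simpa using this
  have s2 : (∑ _t : Fin (C.T d H), ∑ _q : Fin NR, Real.log 2) +
      ∑ _t : Fin (C.T d H), ∑ _q : Fin NR, Real.log κ =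
      C.T d H * (NR * (Real.log 2 + Real.log κ)) := by simp; ring
  have s3 : ∑ t : Fin (C.T d H), ∑ _q : Fin NR,
      2 * ((∑ p, ‖C.codeword p W d H t‖ ^ 2) / P) ≤ C.T d H * (2 * NR * NT) := by
    simp only [Finset.sum_const, Finset.card_univ, Fintype.card_fin, nsmul_eq_mul]
    rw [← Finset.mul_sum, ← Finset.mul_sum, ← Finset.sum_div, Finset.sum_comm]
    have hp : ∑ p, ∑ t, ‖C.codeword p W d H t‖ ^ 2 ≤ NT * (C.T d H * P) := by
      refine (Finset.sum_le_sum fun p _ => C.power p W d H).trans ?_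
      simp
    calc _ ≤ (NR : ℝ) * (2 * (NT * (C.T d H * P) / P)) := by gcongr
      _ = _ := by field_simp
  have s4 : ∑ t : Fin (C.T d H), ∑ _q : Fin NR,
      (if ¬ Reducible l K (H t) then Real.log (1 + P) else 0) =
      NR * Real.log (1 + P) * irreducibleCount l K H (C.T d H) := by
    simp only [Finset.sum_const, Finset.card_univ, Fintype.card_fin, nsmul_eq_mul]
    rw [Fin.sum_univ_eq_sum_range (fun t : ℕ => (NR : ℝ) *
      if ¬ Reducible l K (H t) then Real.log (1 + P) else 0), ← Finset.mul_sum,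
      ← Finset.sum_filter, Finset.sum_const, nsmul_eq_mul, irreducibleCount]
    ring
  have s5 : ∑ t : Fin (C.T d H), ∑ q : Fin NR, 2 * Real.log (rowGain (H t) q) =
      2 * ∑ t ∈ Finset.range (C.T d H), logGain (H t) := by
    simp only [← Finset.mul_sum]
    rw [← Fin.sum_univ_eq_sum_range fun t : ℕ => logGain (H t)]
    rfl
  linarith

/-- The converse for one code and one demand vector with distinct demands. -/
theorem card_mul_le_infoBound {γ : Type} {l : ℕ} {K : ℝ} (hP : 0 < P) (hK : 0 ≤ K)
    {d : Fin NR → Fin L} (hd : Function.Injective d) (H : Channel NT NR) (R : Finset (Fin NR))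
    {c : Fin L → CacheFile F → γ} {e : Fin NR → Fin L → CacheFile F → γ}
    (hce : ∀ q i w w', c i w = c i w' → e q i w = e q i w' → C.ψ q i w = C.ψ q i w') :
    R.card * F * Real.log 2 ≤ infoBound l K P H (C.T d H) + ∑ q ∈ R, fileEntropy (c (d q)) +
      (∑ x ∈ (R ×ˢ R).filter (fun x => x.1 ≤ x.2), fileEntropy (e x.1 (d x.2))) +
      (∑ x ∈ (Finset.univ ×ˢ R).filter
        (fun x : Fin NT × Fin NR => l ≤ (x.1 : ℕ) ∧ l ≤ (x.2 : ℕ)),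
        fileEntropy (C.φ x.1 (d x.2))) +
      ∑ q ∈ R, (Real.log 2 + (C.errorProb d q H).toReal * (F * Real.log 2)) := by
  classical
  have hg := fun (t : Fin (C.T d H)) q => one_le_rowGain (H t) q
  have hn2 : (0 : ℝ) ≤ NR ^ 2 * K := by positivity
  refine C.card_mul_le_of_dominationExponent_le hK (κ := 4 * (NR ^ 2 * K + 1)) le_rfl hd H R hce
    (B := fun q t => if (q : ℕ) < l then P * rowGain (H t) q else 0)
    (B' := fun q t => if Reducible l K (H t) then 0 else P * rowGain (H t) q) ?_ ?_ ?_ ?_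
    (C.dominationExponent_le hP (by linarith) d H _ _ (fun _ _ => rfl) (fun _ _ h => if_pos h)
      fun _ _ h => if_neg h)
  · intro q t
    have := hg t q
    split_ifs <;> positivity
  · intro q t
    have := hg t q
    split_ifs <;> positivity
  · intro W q t h
    have := hg t q
    unfold outputMean
    split_ifs at h ⊢ with hq
    · have : 0 < P * rowGain (H t) q := by positivity
      exact absurd h this.ne'
    · rfl
  · intro W q t h
    have := hg t q
    unfold residualMean
    split_ifs at h ⊢ with hq
    · rfl
    · have : 0 < P * rowGain (H t) q := by positivity
      exact absurd h this.ne'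

end CachingCode

/-! ### Averaging over cyclic demands -/

/-- The receivers that take part in the converse: the first `s₁` ones, and `s₂` of those that
follow the first `l` ones. -/
def activeReceivers (NR l s₁ s₂ : ℕ) : Finset (Fin NR) :=
  Finset.univ.filter fun q => (q : ℕ) < s₁ ∨ l ≤ (q : ℕ) ∧ (q : ℕ) < l + s₂

theorem card_filter_fin (n : ℕ) (p : ℕ → Prop) [DecidablePred p] :
    (Finset.univ.filter fun q : Fin n => p q).card = ((Finset.range n).filter p).card := by
  refine Finset.card_bij (fun q _ => (q : ℕ)) (fun q hq => ?_) (fun _ _ _ _ h => Fin.ext h)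
    fun q hq => ?_
  · simpa using hq
  · rw [Finset.mem_filter, Finset.mem_range] at hq
    exact ⟨⟨q, hq.1⟩, by simpa using hq.2, rfl⟩

theorem card_activeReceivers {NR l s₁ s₂ : ℕ} (h1 : s₁ ≤ l) (h2 : l + s₂ ≤ NR) :
    (activeReceivers NR l s₁ s₂).card = s₁ + s₂ := by
  rw [activeReceivers, card_filter_fin NR fun q => q < s₁ ∨ l ≤ q ∧ q < l + s₂]
  have h : (Finset.range NR).filter (fun q => q < s₁ ∨ l ≤ q ∧ q < l + s₂) =
      Finset.range s₁ ∪ Finset.Ico l (l + s₂) := by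
    ext q
    simp only [Finset.mem_filter, Finset.mem_range, Finset.mem_union, Finset.mem_Ico]
    omega
  rw [h, Finset.card_union_of_disjoint]
  · simp
  · rw [Finset.disjoint_left]
    intro q hq hq'
    simp only [Finset.mem_range, Finset.mem_Ico] at hq hq'
    omega

theorem card_filter_transmitter_receiver {NT NR l s₁ s₂ : ℕ} (h1 : s₁ ≤ l) (h2 : l + s₂ ≤ NR) :
    ((Finset.univ ×ˢ activeReceivers NR l s₁ s₂).filter
      (fun x : Fin NT × Fin NR => l ≤ (x.1 : ℕ) ∧ l ≤ (x.2 : ℕ))).card = (NT - l) * s₂ := by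
  rw [Finset.filter_product (s := Finset.univ) (t := activeReceivers NR l s₁ s₂)
    (fun p : Fin NT => l ≤ (p : ℕ)) fun q : Fin NR => l ≤ (q : ℕ), Finset.card_product]
  congr 1
  · rw [card_filter_fin NT fun p => l ≤ p]
    have h : (Finset.range NT).filter (fun p => l ≤ p) = Finset.Ico l NT := by
      ext q
      simp only [Finset.mem_filter, Finset.mem_range, Finset.mem_Ico]
      omega
    rw [h, Nat.card_Ico]
  · rw [activeReceivers, Finset.filter_filter,
      card_filter_fin NR fun q => (q < s₁ ∨ l ≤ q ∧ q < l + s₂) ∧ l ≤ q]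
    have h : (Finset.range NR).filter (fun q => (q < s₁ ∨ l ≤ q ∧ q < l + s₂) ∧ l ≤ q) =
        Finset.Ico l (l + s₂) := by
      ext q
      simp only [Finset.mem_filter, Finset.mem_range, Finset.mem_Ico]
      omega
    rw [h, Nat.card_Ico, Nat.add_sub_cancel_left]

/-- The ordered pairs and their transposes cover `R ×ˢ R` and overlap in the diagonal. -/
theorem two_mul_card_filter_le {α : Type*} [LinearOrder α] (R : Finset α) :
    2 * ((R ×ˢ R).filter fun x => x.1 ≤ x.2).card = R.card * (R.card + 1) := by
  have h1 : ((R ×ˢ R).filter fun x => x.2 ≤ x.1).card =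
      ((R ×ˢ R).filter fun x => x.1 ≤ x.2).card :=
    Finset.card_bij (fun x _ => (x.2, x.1))
      (fun x hx => by simp only [Finset.mem_filter, Finset.mem_product] at hx ⊢; tauto)
      (fun x _ y _ h => by
        simp only [Prod.mk.injEq] at h; exact Prod.ext h.2 h.1)
      (fun x hx => ⟨(x.2, x.1), by
        simp only [Finset.mem_filter, Finset.mem_product] at hx ⊢; tauto, rfl⟩)
  have h2 : (R ×ˢ R).filter (fun x => x.1 ≤ x.2) ∪ (R ×ˢ R).filter (fun x => x.2 ≤ x.1) =
      R ×ˢ R := by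
    ext x
    simp only [Finset.mem_union, Finset.mem_filter]
    have := le_total x.1 x.2
    tauto
  have h3 : ((R ×ˢ R).filter (fun x => x.1 ≤ x.2) ∩ (R ×ˢ R).filter (fun x => x.2 ≤ x.1)).card =
      R.card := by
    have : (R ×ˢ R).filter (fun x => x.1 ≤ x.2) ∩ (R ×ˢ R).filter (fun x => x.2 ≤ x.1) =
        R.diag := by
      ext x
      simp only [Finset.mem_inter, Finset.mem_filter, Finset.mem_product, Finset.mem_diag]
      constructor
      · rintro ⟨⟨⟨h, _⟩, h'⟩, _, h''⟩
        exact ⟨h, le_antisymm h' h''⟩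
      · rintro ⟨h, h'⟩
        rw [← h']
        exact ⟨⟨⟨h, h⟩, le_rfl⟩, ⟨h, h⟩, le_rfl⟩
    rw [this, Finset.diag_card]
  have h4 := Finset.card_union_add_card_inter ((R ×ˢ R).filter fun x => x.1 ≤ x.2)
    ((R ×ˢ R).filter fun x => x.2 ≤ x.1)
  rw [h2, h3, h1, Finset.card_product] at h4
  linarith [h4]

/-- Receiver `q` requests file `q + a`, cyclically. -/
def cyclicDemand {NR L : ℕ} (hL : NR ≤ L) (a : Fin L) (q : Fin NR) : Fin L := Fin.castLE hL q + a

theorem cyclicDemand_injective {NR L : ℕ} (hL : NR ≤ L) (a : Fin L) :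
    Function.Injective (cyclicDemand hL a) := by
  have : NeZero L := ⟨by have := a.2; omega⟩
  intro q q' h
  exact Fin.castLE_injective hL (add_right_cancel h)

/-- As the shift runs over all residues, each receiver requests every file exactly once. This brings
in the capacity constraints, which concern sums over all files. -/
theorem sum_cyclicDemand {NR L : ℕ} (hL : NR ≤ L) (q : Fin NR) (f : Fin L → ℝ) :
    ∑ a, f (cyclicDemand hL a q) = ∑ i, f i := by
  have : NeZero L := ⟨by have := q.2; omega⟩
  exact Equiv.sum_comp (Equiv.addLeft (Fin.castLE hL q)) f

namespace CachingCode

variable {NT NR L F : ℕ} {μT μR P : ℝ} (C : CachingCode NT NR L F (L * μT) (L * μR) P)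

theorem sum_fileEntropy_tx_le (p : Fin NT) :
    ∑ i, fileEntropy (C.φ p i) ≤ L * μT * F * Real.log 2 := by
  rw [← entropyBits_pi]
  exact mul_le_mul_of_nonneg_right (C.tx_capacity p) (Real.log_nonneg one_le_two)

theorem sum_fileEntropy_rx_le (q : Fin NR) :
    ∑ i, fileEntropy (C.ψ q i) ≤ L * μR * F * Real.log 2 := by
  rw [← entropyBits_pi]
  exact mul_le_mul_of_nonneg_right (C.rx_capacity q) (Real.log_nonneg one_le_two)

/-- The converse for one code, averaged over the cyclic demand vectors. Here `β` is the entropy of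
the parts of the library that every receiver cache contains. -/
theorem mul_le_infoBound_maxT {γ : Type} {l s₁ s₂ : ℕ} (hl : l ≤ NT) (h1 : s₁ ≤ l)
    (h2 : l + s₂ ≤ NR) (hL : NR ≤ L) (hL0 : 0 < L) {K ε β θ : ℝ} (hP : 0 < P) (hK : 0 ≤ K)
    (H : Channel NT NR)
    {c : Fin L → CacheFile F → γ} {e : Fin NR → Fin L → CacheFile F → γ}
    (hce : ∀ q i w w', c i w = c i w' → e q i w = e q i w' → C.ψ q i w = C.ψ q i w')
    (hc : ∑ i, fileEntropy (c i) ≤ β)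
    (he : ∀ q, ∑ i, fileEntropy (e q i) ≤ L * μR * F * Real.log 2 - β)
    (hβ : L * F * θ * Real.log 2 ≤ β) (hε : ∀ d q, (C.errorProb d q H).toReal ≤ ε) :
    ((s₁ : ℝ) + s₂) * F * Real.log 2 ≤ infoBound l K P H (C.maxT H) +
      ((NT - l) * s₂ * μT + ((2 * s₂ + s₁ + 1) / 2 * s₁ + s₂ ^ 2) * μR -
        ((2 * s₂ + s₁) / 2 * (s₁ - 1) + s₂ ^ 2) * θ) * F * Real.log 2 +
      (s₁ + s₂) * (Real.log 2 + ε * (F * Real.log 2)) := by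
  classical
  set R := activeReceivers NR l s₁ s₂ with hR
  have hLpos : (0 : ℝ) < L := by exact_mod_cast hL0
  have hlog2 : 0 ≤ Real.log 2 := Real.log_nonneg one_le_two
  have hRcard : (R.card : ℝ) = s₁ + s₂ := by
    rw [hR, card_activeReceivers h1 h2]; push_cast; rfl
  set pairs := (R ×ˢ R).filter (fun x => x.1 ≤ x.2) with hpairs
  have hpcard : (2 : ℝ) * pairs.card = (s₁ + s₂) * (s₁ + s₂ + 1) := by
    have := two_mul_card_filter_le R
    rw [← hRcard]; exact_mod_cast this
  set tx := (Finset.univ ×ˢ R).filter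
    (fun x : Fin NT × Fin NR => l ≤ (x.1 : ℕ) ∧ l ≤ (x.2 : ℕ)) with htx
  have htcard : (tx.card : ℝ) = (NT - l) * s₂ := by
    rw [htx, hR, card_filter_transmitter_receiver h1 h2]
    push_cast [Nat.cast_sub hl]; rfl
  have key : ∀ a : Fin L, (s₁ + s₂) * F * Real.log 2 ≤ infoBound l K P H (C.maxT H) +
      ∑ q ∈ R, fileEntropy (c (cyclicDemand hL a q)) +
      (∑ x ∈ pairs, fileEntropy (e x.1 (cyclicDemand hL a x.2))) +
      (∑ x ∈ tx, fileEntropy (C.φ x.1 (cyclicDemand hL a x.2))) +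
      (s₁ + s₂) * (Real.log 2 + ε * (F * Real.log 2)) := by
    intro a
    have g1 := C.card_mul_le_infoBound (l := l) hP hK (cyclicDemand_injective hL a) H R hce
    have g2 : infoBound l K P H (C.T (cyclicDemand hL a) H) ≤ infoBound l K P H (C.maxT H) :=
      infoBound_mono hK hP.le H (Finset.le_sup (f := fun d => C.T d H) (Finset.mem_univ _))
    have g3 : ∑ q ∈ R, (Real.log 2 +
        (C.errorProb (cyclicDemand hL a) q H).toReal * (F * Real.log 2)) ≤
        (s₁ + s₂) * (Real.log 2 + ε * (F * Real.log 2)) := by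
      have := Finset.sum_le_card_nsmul R (fun q => Real.log 2 +
        (C.errorProb (cyclicDemand hL a) q H).toReal * (F * Real.log 2))
        (Real.log 2 + ε * (F * Real.log 2)) fun q _ => by
          have := hε (cyclicDemand hL a) q
          gcongr
      rwa [nsmul_eq_mul, hRcard] at this
    rw [hRcard] at g1
    linarith
  have hsum := Finset.sum_le_sum fun a (_ : a ∈ Finset.univ) => key a
  simp only [Finset.sum_add_distrib, Finset.sum_const, Finset.card_univ, Fintype.card_fin,
    nsmul_eq_mul] at hsum
  rw [Finset.sum_comm, Finset.sum_comm (t := pairs), Finset.sum_comm (t := tx)] at hsum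
  simp only [sum_cyclicDemand hL _ fun i => fileEntropy (c i),
    fun x : Fin NR × Fin NR => sum_cyclicDemand hL x.2 fun i => fileEntropy (e x.1 i),
    fun x : Fin NT × Fin NR => sum_cyclicDemand hL x.2 fun i => fileEntropy (C.φ x.1 i)] at hsum
  have k1 : ∑ _q ∈ R, ∑ i, fileEntropy (c i) ≤ (s₁ + s₂) * β := by
    have := Finset.sum_le_card_nsmul R (fun _ => ∑ i, fileEntropy (c i)) β fun _ _ => hc
    rwa [nsmul_eq_mul, hRcard] at this
  have k2 : ∑ x ∈ pairs, ∑ i, fileEntropy (e x.1 i) ≤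
      pairs.card * (L * μR * F * Real.log 2 - β) := by
    have := Finset.sum_le_card_nsmul pairs (fun x => ∑ i, fileEntropy (e x.1 i)) _
      fun x _ => he x.1
    rwa [nsmul_eq_mul] at this
  have k3 : ∑ x ∈ tx, ∑ i, fileEntropy (C.φ x.1 i) ≤
      (NT - l) * s₂ * (L * μT * F * Real.log 2) := by
    have := Finset.sum_le_card_nsmul tx (fun x => ∑ i, fileEntropy (C.φ x.1 i)) _
      fun x _ => C.sum_fileEntropy_tx_le x.1
    rwa [nsmul_eq_mul, htcard] at this
  set n : ℝ := (2 * s₂ + s₁ + 1) / 2 * s₁ + s₂ ^ 2 with hn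
  set m : ℝ := (2 * s₂ + s₁) / 2 * (s₁ - 1) + s₂ ^ 2 with hm
  have hs₂ : (s₂ : ℝ) ≤ s₂ ^ 2 := by
    exact_mod_cast Nat.le_self_pow two_ne_zero s₂
  -- The common entropy `β` is paid once per active receiver instead of `n` times, so `m * β` is
  -- saved.
  have hnm : n - m = s₁ + s₂ := by rw [hn, hm]; ring
  have hm0 : 0 ≤ m := by
    rcases Nat.eq_zero_or_pos s₁ with h0 | h0
    · rw [hm, h0]; push_cast; linarith
    · have : (1 : ℝ) ≤ s₁ := by exact_mod_cast h0
      rw [hm]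
      have : 0 ≤ (2 * (s₂ : ℝ) + s₁) / 2 * (s₁ - 1) := mul_nonneg (by positivity) (by linarith)
      positivity
  -- The number of pairs is `n - s₂ (s₂ - 1) / 2`. Nonnegativity of the other factor comes from the
  -- entropy at some receiver, so `NR = 0` is treated apart.
  have k4 : pairs.card * (L * μR * F * Real.log 2 - β) ≤ n * (L * μR * F * Real.log 2 - β) := by
    rcases Nat.eq_zero_or_pos NR with h0 | h0
    · have e1 : s₁ = 0 := by omega
      have e2 : s₂ = 0 := by omega
      have : (pairs.card : ℝ) = n := by
        rw [hn, e1, e2]; rw [e1, e2] at hpcard; push_cast at hpcard ⊢; linarith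
      rw [this]
    · have : 0 ≤ L * μR * F * Real.log 2 - β :=
        (Finset.sum_nonneg fun i _ => fileEntropy_nonneg _).trans (he ⟨0, h0⟩)
      refine mul_le_mul_of_nonneg_right ?_ this
      rw [hn]
      nlinarith
  have k5 : m * (L * F * θ * Real.log 2) ≤ m * β := mul_le_mul_of_nonneg_left hβ hm0
  refine le_of_mul_le_mul_left ?_ hLpos
  have hβm : (s₁ + s₂) * β = n * β - m * β := by rw [← hnm]; ring
  linarith

end CachingCode

/-! ### Almost sure properties of the channel -/

/-- Fubini in the single coordinate `i`. -/
theorem pi_null_of_forall_update_null {ι : Type*} [Fintype ι] [DecidableEq ι] {E : Type*}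
    [MeasurableSpace E]
    (μ : Measure E) [SigmaFinite μ] (i : ι) {S : Set (ι → E)} (hS : MeasurableSet S)
    (h : ∀ x, μ {v | Function.update x i v ∈ S} = 0) : Measure.pi (fun _ : ι => μ) S = 0 := by
  rw [← lintegral_indicator_one hS]
  have h1 : Measurable (S.indicator (1 : (ι → E) → ℝ≥0∞)) := measurable_one.indicator hS
  rw [lintegral_eq_of_lmarginal_eq (g := 0) {i} h1 measurable_zero]
  · simp
  · rw [lmarginal_singleton, lmarginal_singleton]
    funext x
    have h2 : ∀ v, S.indicator (1 : (ι → E) → ℝ≥0∞) (Function.update x i v) =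
        {v | Function.update x i v ∈ S}.indicator 1 v := fun v => rfl
    simp only [h2]
    have h3 : MeasurableSet {v | Function.update x i v ∈ S} := measurable_update x hS
    rw [lintegral_indicator_one h3, h x]
    simp

/-! ### Leading minors and elimination of the first `l` inputs -/

section Minor

variable {NT NR : ℕ}

/-- The leading `l × l` block of a slot matrix. -/
def leadingBlock {l : ℕ} (hR : l ≤ NR) (hT : l ≤ NT) (M : Fin NR → Fin NT → ℂ) :
    Matrix (Fin l) (Fin l) ℂ := fun i j => M (Fin.castLE hR i) (Fin.castLE hT j)

theorem continuous_leadingBlock {l : ℕ} (hR : l ≤ NR) (hT : l ≤ NT) :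
    Continuous (leadingBlock hR hT) := by
  unfold leadingBlock
  exact continuous_matrix fun i j => by fun_prop

/-- Expansion along the last row: the determinant is affine in its corner entry, with the preceding
leading minor as slope. -/
theorem det_leadingBlock_succ_update {l : ℕ} (hR : l + 1 ≤ NR) (hT : l + 1 ≤ NT)
    (M : Fin NR → Fin NT → ℂ) (v : Fin NT → ℂ) (z z' : ℂ) :
    (leadingBlock hR hT (Function.update M ⟨l, hR⟩ (Function.update v ⟨l, hT⟩ z))).det -
      (leadingBlock hR hT (Function.update M ⟨l, hR⟩ (Function.update v ⟨l, hT⟩ z'))).det =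
      (z - z') * (leadingBlock (Nat.le_of_succ_le hR) (Nat.le_of_succ_le hT) M).det := by
  rw [Matrix.det_succ_row _ (Fin.last l), Matrix.det_succ_row _ (Fin.last l),
    ← Finset.sum_sub_distrib, Fin.sum_univ_castSucc]
  have hrow : ∀ (w : Fin NT → ℂ) (j : Fin (l + 1)),
      leadingBlock hR hT (Function.update M ⟨l, hR⟩ w) (Fin.last l) j = w (Fin.castLE hT j) := by
    intro w j
    have : Fin.castLE hR (Fin.last l) = ⟨l, hR⟩ := rfl
    simp [leadingBlock, this]
  have hsub : ∀ (w : Fin NT → ℂ) (g : Fin l → Fin (l + 1)),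
      (leadingBlock hR hT (Function.update M ⟨l, hR⟩ w)).submatrix (Fin.last l).succAbove g =
      (leadingBlock hR hT M).submatrix (Fin.last l).succAbove g := by
    intro w g
    ext i j
    have : Fin.castLE hR (Fin.castSucc i) ≠ ⟨l, hR⟩ := by
      intro h
      have := congrArg Fin.val h
      simp at this
      have := i.2
      omega
    change Function.update M ⟨l, hR⟩ w (Fin.castLE hR ((Fin.last l).succAbove i)) _ =
      M (Fin.castLE hR ((Fin.last l).succAbove i)) _
    rw [Fin.succAbove_last, Function.update_of_ne this]
  have hlast : (leadingBlock hR hT M).submatrix (Fin.last l).succAbove (Fin.last l).succAbove =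
      leadingBlock (Nat.le_of_succ_le hR) (Nat.le_of_succ_le hT) M := by
    ext i j
    simp [leadingBlock]
  have hlt : Fin.castLE hT (Fin.last l) = ⟨l, hT⟩ := rfl
  simp only [hrow, hsub, hlast, hlt, Function.update_self]
  rw [Finset.sum_eq_zero fun j _ => ?_]
  · rw [Fin.val_last, ← two_mul, pow_mul]
    simp
    ring
  · have : Fin.castLE hT (Fin.castSucc j) ≠ ⟨l, hT⟩ := by
      intro h
      have := congrArg Fin.val h
      simp at this
      have := j.2
      omega
    rw [Function.update_of_ne this, Function.update_of_ne this, sub_self]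

/-- The law of the matrix of one slot. -/
noncomputable def slotLaw (NT NR : ℕ) (ν : Measure ℂ) : Measure (Fin NR → Fin NT → ℂ) :=
  Measure.pi fun _ : Fin NR => Measure.pi fun _ : Fin NT => ν

instance (ν : Measure ℂ) [IsProbabilityMeasure ν] : IsProbabilityMeasure (slotLaw NT NR ν) := by
  unfold slotLaw; infer_instance

/-- Induction on the size. Where the preceding minor does not vanish, at most one value of the
corner entry makes the determinant zero, and `ν` has no atoms. -/
theorem slotLaw_det_eq_zero (ν : Measure ℂ) [IsProbabilityMeasure ν] [NullSingletonClass ν]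
    {l : ℕ} (hR : l ≤ NR) (hT : l ≤ NT) :
    slotLaw NT NR ν {M | (leadingBlock hR hT M).det = 0} = 0 := by
  induction l with
  | zero => simp
  | succ l ih =>
    have ih' := ih (Nat.le_of_succ_le hR) (Nat.le_of_succ_le hT)
    have hm : ∀ {k : ℕ} (hR : k ≤ NR) (hT : k ≤ NT),
        MeasurableSet {M | (leadingBlock hR hT M).det = 0} := fun hR hT =>
      ((continuous_leadingBlock hR hT).matrix_det.measurable) (measurableSet_singleton 0)
    have hsub : {M | (leadingBlock hR hT M).det = 0} ⊆
        {M | (leadingBlock (Nat.le_of_succ_le hR) (Nat.le_of_succ_le hT) M).det = 0} ∪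
        ({M | (leadingBlock hR hT M).det = 0} \
          {M | (leadingBlock (Nat.le_of_succ_le hR) (Nat.le_of_succ_le hT) M).det = 0}) := by
      rw [Set.union_sdiff_self]; exact Set.subset_union_right
    refine measure_mono_null hsub (measure_union_null ih' ?_)
    refine pi_null_of_forall_update_null _ ⟨l, hR⟩ ((hm _ _).diff (hm _ _)) fun M => ?_
    refine pi_null_of_forall_update_null _ ⟨l, hT⟩
      ((measurable_update M) ((hm _ _).diff (hm _ _))) fun v => ?_
    refine Set.Subsingleton.measure_zero (fun z hz z' hz' => ?_) ν
    simp only [Set.mem_ofPred_eq, Set.mem_sdiff] at hz hz'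
    have h1 := det_leadingBlock_succ_update hR hT M v z z'
    rw [hz.1, hz'.1, sub_zero, eq_comm, mul_eq_zero] at h1
    rcases h1 with h | h
    · exact sub_eq_zero.1 h
    -- The smaller block does not meet row `l`, so updating that row leaves its determinant
    -- unchanged.
    · refine absurd ?_ hz.2
      rw [← h]
      congr 1
      ext i j
      have : Fin.castLE (Nat.le_of_succ_le hR) i ≠ ⟨l, hR⟩ := by
        intro h
        have := congrArg Fin.val h
        simp at this
        have := i.2
        omega
      simp [leadingBlock, Function.update_of_ne this]

/-- The coefficients that express the outputs through the outputs of the first `l` receivers. -/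
noncomputable def reductionCoeff {l : ℕ} (hR : l ≤ NR) (hT : l ≤ NT) (M : Fin NR → Fin NT → ℂ)
    (q : Fin NR) (q' : Fin l) : ℂ :=
  ∑ p, M q (Fin.castLE hT p) * (leadingBlock hR hT M)⁻¹ p q'

theorem measurable_reductionCoeff {l : ℕ} (hR : l ≤ NR) (hT : l ≤ NT) (q : Fin NR) (q' : Fin l) :
    Measurable fun M => reductionCoeff hR hT M q q' := by
  have h := continuous_leadingBlock hR hT
  unfold reductionCoeff
  refine Finset.measurable_sum _ fun p _ => Measurable.mul (by fun_prop) ?_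
  simp only [Matrix.inv_def, Matrix.smul_apply, Ring.inverse_eq_inv', smul_eq_mul]
  refine (h.matrix_det.measurable.inv).mul ?_
  exact (h.matrix_adjugate.matrix_elem p q').measurable

/-- The sum of the squared moduli of the reduction coefficients. -/
noncomputable def reductionSize {l : ℕ} (hR : l ≤ NR) (hT : l ≤ NT) (M : Fin NR → Fin NT → ℂ) : ℝ :=
  ∑ q, ∑ q', ‖reductionCoeff hR hT M q q'‖ ^ 2

theorem measurable_reductionSize {l : ℕ} (hR : l ≤ NR) (hT : l ≤ NT) :
    Measurable (reductionSize hR hT) := by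
  unfold reductionSize
  exact Finset.measurable_sum _ fun q _ => Finset.measurable_sum _ fun q' _ =>
    (measurable_reductionCoeff hR hT q q').norm.pow_const 2

/-- Inverting the leading block eliminates the first `l` inputs in favour of the first `l` outputs;
`b` collects what remains on the other transmitters. -/
theorem reducible_of_det_ne_zero {l : ℕ} (hR : l ≤ NR) (hT : l ≤ NT) {K : ℝ}
    {M : Fin NR → Fin NT → ℂ} (hdet : (leadingBlock hR hT M).det ≠ 0)
    (hK : reductionSize hR hT M ≤ K) : Reducible l K M := by
  classical
  have hK0 : 0 ≤ K := le_trans (Finset.sum_nonneg fun _ _ => Finset.sum_nonneg fun _ _ => by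
    positivity) hK
  let a : Fin NR → Fin NR → ℂ := fun q q' =>
    if h : (q' : ℕ) < l then reductionCoeff hR hT M q ⟨q', h⟩ else 0
  have hsum : ∀ q p, ∑ q', a q q' * M q' p =
      ∑ q' : Fin l, reductionCoeff hR hT M q q' * M (Fin.castLE hR q') p := by
    intro q p
    symm
    refine Finset.sum_of_injOn (Fin.castLE hR) (Fin.castLE_injective hR).injOn (by simp) ?_ ?_
    · intro q' _ hq'
      have : ¬ (q' : ℕ) < l := fun h => hq' ⟨⟨q', h⟩, by simp, rfl⟩
      simp [a, this]
    · intro q' _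
      simp [a]
  refine ⟨a, fun q p => if (p : ℕ) < l then 0 else M q p - ∑ q', a q q' * M q' p, ?_, ?_, ?_, ?_⟩
  · intro q q'
    by_cases h : (q' : ℕ) < l
    · simp only [a, dif_pos h]
      refine le_trans ?_ hK
      refine le_trans ?_ (Finset.single_le_sum (f := fun q => ∑ q', ‖reductionCoeff hR hT M q q'‖ ^ 2)
        (fun _ _ => Finset.sum_nonneg fun _ _ => by positivity) (Finset.mem_univ q))
      exact Finset.single_le_sum (f := fun q' => ‖reductionCoeff hR hT M q q'‖ ^ 2)
        (fun _ _ => by positivity) (Finset.mem_univ _)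
    · simpa [a, h] using hK0
  · intro q q' h
    simp [a, not_lt.2 h]
  · intro q p h
    simp [h]
  · intro q p
    by_cases h : (p : ℕ) < l
    · dsimp only
      rw [if_pos h, add_zero, hsum]
      have hu : IsUnit (leadingBlock hR hT M).det := hdet.isUnit
      have h1 : ∀ q' : Fin l, M (Fin.castLE hR q') p = leadingBlock hR hT M q' ⟨p, h⟩ :=
        fun q' => rfl
      simp only [h1, reductionCoeff, Finset.sum_mul, mul_assoc]
      rw [Finset.sum_comm]
      simp only [← Finset.mul_sum, ← Matrix.mul_apply, Matrix.nonsing_inv_mul _ hu,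
        Matrix.one_apply, mul_ite, mul_one, mul_zero, Finset.sum_ite_eq', Finset.mem_univ, if_true]
      rfl
    · dsimp only
      rw [if_neg h]; ring

theorem measurable_logGain : Measurable (logGain : (Fin NR → Fin NT → ℂ) → ℝ) := by
  unfold logGain rowGain
  fun_prop

/-- Taking logarithms, the logarithmic gain is at most `2 ∑ log (1 + ‖h‖)`, which makes it
integrable. -/
theorem one_add_sum_sq_le_prod {ι : Type*} (s : Finset ι) (x : ι → ℝ) (hx : ∀ i, 0 ≤ x i) :
    1 + ∑ i ∈ s, x i ^ 2 ≤ ∏ i ∈ s, (1 + x i) ^ 2 := by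
  classical
  induction s using Finset.induction_on with
  | empty => simp
  | insert i s hi ih =>
    rw [Finset.sum_insert hi, Finset.prod_insert hi]
    have h1 : 0 ≤ ∑ i ∈ s, x i ^ 2 := Finset.sum_nonneg fun _ _ => by positivity
    have h2 : (1 + x i) ^ 2 * (1 + ∑ i ∈ s, x i ^ 2) ≤ (1 + x i) ^ 2 * ∏ i ∈ s, (1 + x i) ^ 2 := by
      gcongr
    nlinarith [hx i, mul_nonneg (hx i) h1, mul_nonneg (sq_nonneg (x i)) h1]

theorem integrable_logGain (ν : Measure ℂ) [IsProbabilityMeasure ν]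
    (hν : Integrable (fun h : ℂ => Real.log (1 + ‖h‖)) ν) :
    Integrable logGain (slotLaw NT NR ν) := by
  have h1 : ∀ (q : Fin NR) (p : Fin NT),
      Integrable (fun M : Fin NR → Fin NT → ℂ => Real.log (1 + ‖M q p‖)) (slotLaw NT NR ν) := by
    intro q p
    have hmp := (measurePreserving_eval (fun _ : Fin NT => ν) p).comp
      (measurePreserving_eval (fun _ : Fin NR => Measure.pi fun _ : Fin NT => ν) q)
    exact hmp.integrable_comp_of_integrable hν
  have h2 : Integrable (fun M : Fin NR → Fin NT → ℂ => ∑ q, ∑ p, 2 * Real.log (1 + ‖M q p‖))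
      (slotLaw NT NR ν) :=
    integrable_finsetSum _ fun q _ => integrable_finsetSum _ fun p _ => (h1 q p).const_mul 2
  refine h2.mono' measurable_logGain.aestronglyMeasurable (ae_of_all _ fun M => ?_)
  have hg := one_le_rowGain M
  rw [logGain, Real.norm_of_nonneg (Finset.sum_nonneg fun q _ => Real.log_nonneg (hg q))]
  refine Finset.sum_le_sum fun q _ => ?_
  calc Real.log (rowGain M q) ≤ Real.log (∏ p, (1 + ‖M q p‖) ^ 2) :=
        Real.log_le_log (by linarith [hg q])
          (one_add_sum_sq_le_prod _ (fun p => ‖M q p‖) fun _ => norm_nonneg _)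
    _ = ∑ p, 2 * Real.log (1 + ‖M q p‖) := by
        rw [Real.log_prod fun p _ => by positivity]
        simp [Real.log_pow]

end Minor

/-! ### Regularity of almost every channel -/

/-- A channel realization for which the logarithmic gains grow at most linearly and, for a suitable
bound, the proportion of irreducible slots is arbitrarily small. -/
def IsRegularChannel {NT NR : ℕ} (l : ℕ) (H : Channel NT NR) : Prop :=
  (∃ G : ℝ, ∀ T : ℕ, ∑ t ∈ Finset.range T, logGain (H t) ≤ G * T) ∧
    ∀ ε : ℝ, 0 < ε → ∃ K : ℝ, 0 ≤ K ∧ ∃ c : ℝ, ∀ T : ℕ, irreducibleCount l K H T ≤ ε * T + c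

theorem ae_tendsto_avg_infinitePi {E : Type*} [MeasurableSpace E] (ρ : Measure E)
    [IsProbabilityMeasure ρ] {g : E → ℝ} (hg : Measurable g) (hi : Integrable g ρ) :
    ∀ᵐ H ∂(Measure.infinitePi fun _ : ℕ => ρ),
      Tendsto (fun T : ℕ => (∑ t ∈ Finset.range T, g (H t)) / T) atTop (𝓝 (∫ M, g M ∂ρ)) := by
  have hmp := fun t : ℕ => measurePreserving_eval_infinitePi (fun _ : ℕ => ρ) t
  have h := strong_law_ae_real (μ := Measure.infinitePi fun _ : ℕ => ρ)
    (fun t H => g (H t)) ((hmp 0).integrable_comp_of_integrable hi)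
    (fun s t hst => (iIndepFun_infinitePi (P := fun _ : ℕ => ρ) (X := fun _ => g)
      fun _ => hg).indepFun hst)
    (fun t => ⟨(hg.comp (measurable_pi_apply t)).aemeasurable,
      (hg.comp (measurable_pi_apply 0)).aemeasurable, by
        have h1 : ∀ t : ℕ, (Measure.infinitePi fun _ : ℕ => ρ).map (fun H => g (H t)) = ρ.map g :=
          fun t => by
            rw [← (hmp t).map_eq, Measure.map_map hg (hmp t).measurable, (hmp t).map_eq]
            rfl
        rw [h1, h1]⟩)
  have he := integral_map (hmp 0).measurable.aemeasurable
    (hg.aestronglyMeasurable (μ := (Measure.infinitePi fun _ : ℕ => ρ).map (Function.eval 0)))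
  rw [(hmp 0).map_eq] at he
  filter_upwards [h] with H hH
  rwa [he]

/-- Convergent sequences are bounded; `h0` covers `T = 0`, where the quotient carries no
information. -/
theorem exists_forall_le_mul_of_tendsto_avg {u : ℕ → ℝ} (h0 : u 0 = 0) {a : ℝ}
    (h : Tendsto (fun T : ℕ => u T / T) atTop (𝓝 a)) : ∃ G : ℝ, ∀ T : ℕ, u T ≤ G * T := by
  obtain ⟨G, hG⟩ := h.bddAbove_range
  refine ⟨G, fun T => ?_⟩
  rcases Nat.eq_zero_or_pos T with rfl | hT
  · simp [h0]
  · have : u T / T ≤ G := hG ⟨T, rfl⟩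
    rwa [div_le_iff₀ (by exact_mod_cast hT)] at this

/-- The strong law is applied to the measurable set on the right rather than to irreducibility
itself. -/
theorem irreducibleCount_le {NT NR l : ℕ} (hR : l ≤ NR) (hT : l ≤ NT) (K : ℝ)
    (H : Channel NT NR) (T : ℕ) :
    (irreducibleCount l K H T : ℝ) ≤ ∑ t ∈ Finset.range T,
      ({M | (leadingBlock hR hT M).det = 0 ∨ K < reductionSize hR hT M}.indicator
        (fun _ => (1 : ℝ)) (H t)) := by
  classical
  rw [irreducibleCount, Finset.card_filter, Nat.cast_sum]
  refine Finset.sum_le_sum fun t _ => ?_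
  by_cases h : H t ∈ {M | (leadingBlock hR hT M).det = 0 ∨ K < reductionSize hR hT M}
  · rw [Set.indicator_of_mem h]
    split_ifs <;> simp
  · rw [Set.indicator_of_notMem h]
    simp only [Set.mem_ofPred_eq, not_or, not_lt] at h
    rw [if_neg (not_not.2 (reducible_of_det_ne_zero hR hT h.1 h.2))]
    simp

/-- Almost every channel realization is regular. -/
theorem ae_isRegularChannel {NT NR l : ℕ} (hR : l ≤ NR) (hT : l ≤ NT) (ν : Measure ℂ)
    [IsProbabilityMeasure ν] [NullSingletonClass ν] (fading : Fading)
    (hν : fading = Fading.timeVarying → Integrable (fun h : ℂ => Real.log (1 + ‖h‖)) ν) :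
    ∀ᵐ H ∂channelLaw NT NR ν fading, IsRegularChannel l H := by
  have hdet := slotLaw_det_eq_zero (NT := NT) (NR := NR) ν hR hT
  have hmdet : MeasurableSet {M : Fin NR → Fin NT → ℂ | (leadingBlock hR hT M).det = 0} :=
    (continuous_leadingBlock hR hT).matrix_det.measurable (measurableSet_singleton 0)
  cases fading with
  | timeVarying =>
    let bad : ℕ → Set (Fin NR → Fin NT → ℂ) := fun K =>
      {M | (leadingBlock hR hT M).det = 0 ∨ (K : ℝ) < reductionSize hR hT M}
    have hmbad : ∀ K, MeasurableSet (bad K) := fun K =>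
      hmdet.union (measurableSet_lt measurable_const (measurable_reductionSize hR hT))
    have hanti : Antitone bad := fun K K' hKK' M hM => by
      rcases hM with h | h
      · exact Or.inl h
      · exact Or.inr (lt_of_le_of_lt (by exact_mod_cast hKK') h)
    -- The sets decrease to the null set of singular leading blocks, as `reductionSize` is finite.
    have hlim : Tendsto (fun K => slotLaw NT NR ν (bad K)) atTop (𝓝 0) := by
      have h1 := tendsto_measure_iInter_atTop (μ := slotLaw NT NR ν)
        (fun K => (hmbad K).nullMeasurableSet) hanti ⟨0, measure_ne_top _ _⟩
      have h2 : slotLaw NT NR ν (⋂ K, bad K) = 0 := by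
        refine measure_mono_null (fun M hM => ?_) hdet
        obtain ⟨K, hK⟩ := exists_nat_ge (reductionSize hR hT M)
        rcases Set.mem_iInter.1 hM K with h | h
        · exact h
        · exact absurd h (not_lt.2 hK)
      rwa [h2] at h1
    have a1 := ae_tendsto_avg_infinitePi (slotLaw NT NR ν) measurable_logGain
      (integrable_logGain ν (hν rfl))
    have a2 : ∀ᵐ H ∂(Measure.infinitePi fun _ : ℕ => slotLaw NT NR ν), ∀ K : ℕ,
        Tendsto (fun T : ℕ => (∑ t ∈ Finset.range T, (bad K).indicator (fun _ => (1 : ℝ)) (H t)) / T)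
          atTop (𝓝 (∫ M, (bad K).indicator (fun _ => (1 : ℝ)) M ∂(slotLaw NT NR ν))) :=
      ae_all_iff.2 fun K => ae_tendsto_avg_infinitePi _ (measurable_const.indicator (hmbad K))
        ((integrable_const _).indicator (hmbad K))
    change ∀ᵐ H ∂(Measure.infinitePi fun _ : ℕ => slotLaw NT NR ν), IsRegularChannel l H
    filter_upwards [a1, a2] with H h1 h2
    refine ⟨exists_forall_le_mul_of_tendsto_avg (by simp) h1, fun ε hε => ?_⟩
    obtain ⟨K, hK⟩ := (hlim.eventually (gt_mem_nhds (ENNReal.ofReal_pos.2 hε))).exists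
    have h3 := h2 K
    rw [integral_indicator_const _ (hmbad K), smul_eq_mul, mul_one] at h3
    have h4 : (slotLaw NT NR ν).real (bad K) < ε := by
      have := (ENNReal.toReal_lt_toReal (measure_ne_top _ _) ENNReal.ofReal_ne_top).2 hK
      rwa [ENNReal.toReal_ofReal hε.le] at this
    obtain ⟨T₀, hT₀⟩ := eventually_atTop.1 (h3.eventually (gt_mem_nhds h4))
    -- The additive constant `T₀` pays for the initial slots, before the empirical frequency falls
    -- below `ε`.
    refine ⟨K, K.cast_nonneg, T₀, fun T => ?_⟩
    have h5 := irreducibleCount_le hR hT K H T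
    rcases le_or_gt T T₀ with hT | hT
    · have h6 : irreducibleCount l K H T ≤ T := by
        classical
        exact (Finset.card_filter_le _ _).trans (by simp)
      have h7 : (irreducibleCount l K H T : ℝ) ≤ T₀ := by exact_mod_cast h6.trans hT
      have : 0 ≤ ε * T := by positivity
      linarith
    · have h6 := hT₀ T hT.le
      have hTpos : (0 : ℝ) < T := by exact_mod_cast lt_of_le_of_lt (Nat.zero_le _) hT
      rw [div_lt_iff₀ hTpos] at h6
      have : (0 : ℝ) ≤ T₀ := T₀.cast_nonneg
      exact h5.trans (by linarith)
  | static =>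
    have hmeas : Measurable fun (G : Fin NR → Fin NT → ℂ) (_ : ℕ) => G :=
      measurable_pi_lambda _ fun _ => measurable_id
    have hset : MeasurableSet {H : Channel NT NR |
        (leadingBlock hR hT (H 0)).det ≠ 0 ∧ ∀ t, H t = H 0} := by
      have h0 : ∀ t : ℕ, Measurable fun H : Channel NT NR => H t := measurable_pi_apply
      have s1 : MeasurableSet {H : Channel NT NR | (leadingBlock hR hT (H 0)).det ≠ 0} :=
        h0 0 hmdet.compl
      have s2 : MeasurableSet {H : Channel NT NR | ∀ t, H t = H 0} := by
        have : {H : Channel NT NR | ∀ t, H t = H 0} = ⋂ t, {H | H t = H 0} := by ext; simp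
        rw [this]
        exact MeasurableSet.iInter fun t => measurableSet_eq_fun (h0 t) (h0 0)
      exact s1.inter s2
    have hae : ∀ᵐ H ∂channelLaw NT NR ν .static,
        (leadingBlock hR hT (H 0)).det ≠ 0 ∧ ∀ t, H t = H 0 := by
      change ∀ᵐ H ∂(slotLaw NT NR ν).map fun G (_ : ℕ) => G, _
      rw [ae_map_iff hmeas.aemeasurable hset]
      have : ∀ᵐ M ∂slotLaw NT NR ν, (leadingBlock hR hT M).det ≠ 0 := by
        rw [ae_iff]; simpa using hdet
      filter_upwards [this] with M hM
      exact ⟨hM, fun _ => rfl⟩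
    filter_upwards [hae] with H hH
    -- The bound `K` may depend on the realization, so the size of the one fixed matrix makes every
    -- slot reducible.
    refine ⟨⟨logGain (H 0), fun T => ?_⟩, fun ε hε => ⟨reductionSize hR hT (H 0), ?_, 0, fun T => ?_⟩⟩
    · simp only [hH.2, Finset.sum_const, Finset.card_range, nsmul_eq_mul]
      rw [mul_comm]
    · exact Finset.sum_nonneg fun _ _ => Finset.sum_nonneg fun _ _ => by positivity
    · have hred : ∀ t, Reducible l (reductionSize hR hT (H 0)) (H t) := fun t => by
        rw [hH.2 t]
        exact reducible_of_det_ne_zero hR hT hH.1 le_rfl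
      have : irreducibleCount l (reductionSize hR hT (H 0)) H T = 0 := by
        classical
        rw [irreducibleCount, Finset.card_eq_zero, Finset.filter_eq_empty_iff]
        exact fun t _ => not_not.2 (hred t)
      rw [this]
      push_cast
      positivity

/-! ### Schemes without intra-file coding -/

/-- The bits of a file in the positions `A`. -/
def maskFile {F : ℕ} (A : Finset (Fin F)) (w : CacheFile F) : CacheFile F :=
  fun b => if b ∈ A then w b else false

theorem maskFile_eq_iff {F : ℕ} (A : Finset (Fin F)) (w w' : CacheFile F) :
    maskFile A w = maskFile A w' ↔ ∀ b ∈ A, w b = w' b := by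
  unfold maskFile
  constructor
  · intro h b hb
    simpa [hb] using congrFun h b
  · intro h
    funext b
    split_ifs with hb
    · exact h b hb
    · rfl

theorem fileEntropy_maskFile {F : ℕ} (A : Finset (Fin F)) :
    fileEntropy (maskFile A) = A.card * Real.log 2 :=
  fileEntropy_eq_card _ A (maskFile_eq_iff A)

namespace CachingCode

variable {NT NR L F : ℕ} {MT MR P : ℝ} (C : CachingCode NT NR L F MT MR P)

/-- If the requested file can be altered without changing any cached content, then the error
probability is at least one half. -/
theorem half_le_errorProb {d : Fin NR → Fin L} {q : Fin NR} (H : Channel NT NR)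
    {σ : Library L F → Library L F} (hσ : Function.Involutive σ)
    (hne : ∀ W, σ W (d q) ≠ W (d q)) (hφ : ∀ p i W, C.φ p i (σ W i) = C.φ p i (W i))
    (hψ : ∀ i W, C.ψ q i (σ W i) = C.ψ q i (W i)) : 1 / 2 ≤ C.errorProb d q H := by
  have hrec : ∀ W z, C.received q (σ W) d H z = C.received q W d H z := fun W z => by
    funext t
    simp only [received, codeword, hφ]
  have hdec : ∀ W z, C.decoded q (σ W) d H z = C.decoded q W d H z := fun W z => by
    simp only [decoded, hψ, hrec]
  -- For equal noise the decoder gives the same answer for `W` and `σ W`, so at least one of the two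
  -- is decoded wrongly.
  have h1 : ∀ W, 1 ≤ noiseLaw (C.T d H) {z | C.decoded q W d H z ≠ W (d q)} +
      noiseLaw (C.T d H) {z | C.decoded q (σ W) d H z ≠ σ W (d q)} := fun W => by
    rw [← measure_univ (μ := noiseLaw (C.T d H))]
    refine (measure_mono fun z _ => ?_).trans (measure_union_le _ _)
    by_contra hz
    simp only [Set.mem_union, Set.mem_ofPred_eq, not_or, not_not, hdec] at hz
    exact hne W (hz.2.symm.trans hz.1)
  have h2 := Finset.sum_le_sum fun W (_ : W ∈ (Finset.univ : Finset (Library L F))) => h1 W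
  have h3 : ∑ W, noiseLaw (C.T d H) {z | C.decoded q (σ W) d H z ≠ σ W (d q)} =
      ∑ W, noiseLaw (C.T d H) {z | C.decoded q W d H z ≠ W (d q)} :=
    Equiv.sum_comp hσ.toPerm fun W => noiseLaw (C.T d H) {z | C.decoded q W d H z ≠ W (d q)}
  rw [Finset.sum_add_distrib, h3, ← two_mul, Finset.sum_const, Finset.card_univ, nsmul_eq_mul, mul_one] at h2
  rw [errorProb, ENNReal.le_div_iff_mul_le (Or.inl (by simp)) (Or.inl (by simp)), one_div,
    ENNReal.inv_mul_le_iff two_ne_zero ENNReal.ofNat_ne_top]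
  exact h2

/-- Without intra-file coding, and with small error probability, the bits that no transmitter
has cached are cached by every receiver. -/
theorem uncoded_subset {Atx : Fin NT → Fin L → Finset (Fin F)}
    {Arx : Fin NR → Fin L → Finset (Fin F)}
    (htx : ∀ p i w w', C.φ p i w = C.φ p i w' ↔ ∀ b ∈ Atx p i, w b = w' b)
    (hrx : ∀ q i w w', C.ψ q i w = C.ψ q i w' ↔ ∀ b ∈ Arx q i, w b = w' b)
    (H : Channel NT NR) (herr : C.worstErrorProb H < 1 / 2) (q : Fin NR) (i : Fin L) (b : Fin F)
    (hb : ∀ p, b ∉ Atx p i) : b ∈ Arx q i := by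
  by_contra hbq
  -- Flip bit `b` of file `i`; the test demand has every receiver request that file.
  let σ : Library L F → Library L F := fun W =>
    Function.update W i (Function.update (W i) b (!(W i b)))
  have hself : ∀ W, σ W i = Function.update (W i) b (!(W i b)) := fun W => Function.update_self ..
  have hbit : ∀ (A : Finset (Fin F)), b ∉ A → ∀ W, ∀ b' ∈ A, σ W i b' = W i b' := by
    intro A hA W b' hb'
    have : b' ≠ b := fun h => hA (h ▸ hb')
    rw [hself, Function.update_of_ne this]
  have hother : ∀ j, j ≠ i → ∀ W, σ W j = W j := fun j hj W => Function.update_of_ne hj ..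
  have h := C.half_le_errorProb (d := fun _ => i) (q := q) H (σ := σ) (fun W => ?_) (fun W h => ?_)
    (fun p j W => ?_) (fun j W => ?_)
  · have h1 : C.errorProb (fun _ => i) q H ≤ C.worstErrorProb H :=
      le_iSup_of_le (fun _ => i) (le_iSup (fun q => C.errorProb (fun _ => i) q H) q)
    exact absurd (h.trans h1) (not_le.2 herr)
  · funext j
    by_cases hj : j = i
    · subst hj
      rw [hself, hself]
      simp
    · rw [hother j hj, hother j hj]
  · have := congrFun h b
    rw [hself, Function.update_self] at this
    simp at this
  · by_cases hj : j = i
    · subst hj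
      exact (htx _ _ _ _).2 (hbit _ (hb p) W)
    · rw [hother j hj]
  · by_cases hj : j = i
    · subst hj
      exact (hrx _ _ _ _).2 (hbit _ hbq W)
    · rw [hother j hj]

end CachingCode

/-- The data that the averaged converse uses: common parts `c` of the receiver caches, of total
entropy `β`, and remaining parts `e`. -/
def HasCommonParts {NT NR L F : ℕ} {μT μR P : ℝ}
    (C : CachingCode NT NR L F (L * μT) (L * μR) P) (θ : ℝ) : Prop :=
  ∃ (γ : Type) (c : Fin L → CacheFile F → γ) (e : Fin NR → Fin L → CacheFile F → γ) (β : ℝ),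
    (∀ q i w w', c i w = c i w' → e q i w = e q i w' → C.ψ q i w = C.ψ q i w') ∧
    ∑ i, fileEntropy (c i) ≤ β ∧
    (∀ q, ∑ i, fileEntropy (e q i) ≤ L * μR * F * Real.log 2 - β) ∧
    L * F * θ * Real.log 2 ≤ β

section CommonParts

variable {NT NR L F : ℕ} {μT μR P : ℝ} (C : CachingCode NT NR L F (L * μT) (L * μR) P)

theorem hasCommonParts_zero : HasCommonParts C 0 :=
  ⟨ℕ, fun _ _ => 0, C.ψ, 0, fun _ _ _ _ _ h => h, by simp [fileEntropy_const],
    fun q => by simpa using C.sum_fileEntropy_rx_le q, by simp⟩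

/-- The common part consists of the bits in no transmitter cache, which all receivers must hold. A
union bound over the transmitter caches leaves at least `L F (1 - NT μT)` of them. -/
theorem hasCommonParts_of_uncoded (htx : ∀ p i, IsUncoded (C.φ p i))
    (hrx : ∀ q i, IsUncoded (C.ψ q i)) (H : Channel NT NR) (herr : C.worstErrorProb H < 1 / 2) :
    HasCommonParts C (max (1 - NT * μT) 0) := by
  classical
  have hfin : ∀ {f : CacheFile F → ℕ}, IsUncoded f →
      ∃ A : Finset (Fin F), ∀ w w', f w = f w' ↔ ∀ b ∈ A, w b = w' b := fun ⟨A, hA⟩ =>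
    ⟨A.toFinset, by simpa using hA⟩
  choose Atx hAtx using fun p i => hfin (htx p i)
  choose Arx hArx using fun q i => hfin (hrx q i)
  let B : Fin L → Finset (Fin F) := fun i => Finset.univ.filter fun b => ∀ p, b ∉ Atx p i
  have hB : ∀ q i, B i ⊆ Arx q i := fun q i b hb =>
    C.uncoded_subset hAtx hArx H herr q i b (by simpa [B] using hb)
  have hlog2 : 0 < Real.log 2 := Real.log_pos one_lt_two
  refine ⟨CacheFile F, fun i => maskFile (B i), fun q i => maskFile (Arx q i \ B i),
    ∑ i, (B i).card * Real.log 2, ?_, ?_, ?_, ?_⟩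
  · intro q i w w' h1 h2
    rw [maskFile_eq_iff] at h1 h2
    refine (hArx q i w w').2 fun b hb => ?_
    by_cases hb' : b ∈ B i
    · exact h1 b hb'
    · exact h2 b (Finset.mem_sdiff.2 ⟨hb, hb'⟩)
  · simp only [fileEntropy_maskFile]; exact le_rfl
  · intro q
    have h1 := C.sum_fileEntropy_rx_le q
    simp only [fun i => fileEntropy_eq_card (C.ψ q i) (Arx q i) (hArx q i)] at h1
    simp only [fileEntropy_maskFile]
    rw [le_sub_iff_add_le, ← Finset.sum_add_distrib]
    refine le_trans (le_of_eq (Finset.sum_congr rfl fun i _ => ?_)) h1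
    rw [← add_mul]
    congr 1
    exact_mod_cast Finset.card_sdiff_add_card_eq_card (hB q i)
  · rw [← Finset.sum_mul]
    refine mul_le_mul_of_nonneg_right ?_ hlog2.le
    have h1 : ∀ p, ∑ i, ((Atx p i).card : ℝ) ≤ L * μT * F := fun p => by
      have h1 := C.sum_fileEntropy_tx_le p
      simp only [fun i => fileEntropy_eq_card (C.φ p i) (Atx p i) (hAtx p i)] at h1
      rw [← Finset.sum_mul] at h1
      exact le_of_mul_le_mul_right h1 hlog2
    have h2 : ∀ i, (F : ℝ) ≤ (B i).card + ∑ p, ((Atx p i).card : ℝ) := fun i => by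
      have h3 : (Finset.univ : Finset (Fin F)) ⊆
          B i ∪ Finset.univ.biUnion fun p => Atx p i := fun b _ => by
        by_cases h : ∀ p, b ∉ Atx p i
        · exact Finset.mem_union_left _ (by simpa [B] using h)
        · push Not at h
          exact Finset.mem_union_right _ (by simpa using h)
      have h4 := (Finset.card_le_card h3).trans ((Finset.card_union_le _ _).trans
        (Nat.add_le_add_left Finset.card_biUnion_le _))
      rw [Finset.card_univ, Fintype.card_fin] at h4
      exact_mod_cast h4
    have h5 := Finset.sum_le_sum fun i (_ : i ∈ Finset.univ) => h2 i
    rw [Finset.sum_add_distrib, Finset.sum_comm, Finset.sum_const, Finset.card_univ,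
      Fintype.card_fin, nsmul_eq_mul] at h5
    have h6 : ∑ p : Fin NT, ∑ i, ((Atx p i).card : ℝ) ≤ NT * (L * μT * F) := by
      have := Finset.sum_le_card_nsmul Finset.univ (fun p : Fin NT => ∑ i, ((Atx p i).card : ℝ)) _
        fun p _ => h1 p
      simpa using this
    rcases max_cases (1 - NT * μT) 0 with ⟨h, _⟩ | ⟨h, _⟩
    · rw [h]; linarith
    · rw [h]
      simp only [mul_zero]
      exact Finset.sum_nonneg fun _ _ => by positivity

end CommonParts

/-! ### The normalized delivery time -/

namespace CachingScheme

variable {NT NR L : ℕ} {μT μR : ℝ} (S : CachingScheme NT NR L μT μR)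

theorem le_ndtAt_of_eventually {H : Channel NT NR} {y : ℝ}
    (h : ∀ᶠ P : ℝ in atTop, ∀ᶠ F : ℕ in atTop,
      y ≤ ((S P F).maxT H : ℝ) / (F / Real.logb 2 P)) : (y : EReal) ≤ S.ndtAt H := by
  refine le_limsup_of_frequently_le' (Eventually.frequently ?_)
  filter_upwards [h] with P hP
  refine le_limsup_of_frequently_le' (Eventually.frequently ?_)
  filter_upwards [hP] with F hF
  exact EReal.coe_le_coe_iff.2 hF

theorem zero_le_ndtAt (H : Channel NT NR) : 0 ≤ S.ndtAt H := by
  refine S.le_ndtAt_of_eventually (y := 0) ?_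
  filter_upwards [eventually_ge_atTop 1] with P hP
  refine Eventually.of_forall fun F => ?_
  have : 0 ≤ Real.logb 2 P := Real.logb_nonneg one_lt_two hP
  positivity

/-- The rate per slot is `(l + NR ε) log P` plus a constant independent of `P`; the remaining term
does not grow with `T`, so it is negligible as `F → ∞`. -/
theorem infoBound_le {l : ℕ} {K P ε G c : ℝ} (hP : 1 ≤ P) {H : Channel NT NR}
    (hG : ∀ T : ℕ, ∑ t ∈ Finset.range T, logGain (H t) ≤ G * T)
    (hc : ∀ T : ℕ, irreducibleCount l K H T ≤ ε * T + c) (hε : 0 ≤ ε) (T : ℕ) :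
    infoBound l K P H T ≤ T * ((l + NR * ε) * Real.log P +
      ((l + NR * ε) * Real.log 2 + NR * (Real.log 2 + Real.log (4 * (NR ^ 2 * K + 1))) +
        2 * NR * NT + 2 * G)) + NR * Real.log (1 + P) * c := by
  have h1 : Real.log (1 + P) ≤ Real.log P + Real.log 2 := by
    rw [← Real.log_mul (by positivity) two_ne_zero]
    exact Real.log_le_log (by positivity) (by linarith)
  have h0 : 0 ≤ Real.log (1 + P) := Real.log_nonneg (by linarith)
  have h2 : NR * Real.log (1 + P) * irreducibleCount l K H T ≤
      NR * Real.log (1 + P) * (ε * T + c) := by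
    gcongr
    exact hc T
  have h3 : T * ((l + NR * ε) * Real.log (1 + P)) ≤
      T * ((l + NR * ε) * (Real.log P + Real.log 2)) := by gcongr
  have h4 := hG T
  unfold infoBound
  linarith

/-- If `T` were smaller, the three terms on the right of `h` would use at most `A - g / 2`, less
than `g / 4`, and at most `g / 4` of the budget `A`, both in units of `F * b`. -/
theorem le_mul_of_info_budget {A T α β s δ g y p F b : ℝ} (hα : 0 ≤ α) (hp : 0 < p) (hF : 0 < F)
    (hb : 0 < b) (hδ : s * δ ≤ g / 4) (hy : y * α ≤ (A - g / 2) * p) (hβ : β < g / 4 * b * F)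
    (h : A * F * b ≤ T * α + β + s * δ * (F * b)) : y * F * b ≤ T * p := by
  by_contra! hlt
  have m2 : s * δ * (F * b) ≤ g / 4 * (F * b) := by gcongr
  have m3 : T * α ≤ (A - g / 2) * (F * b) := by
    refine le_of_mul_le_mul_right ?_ hp
    calc T * α * p = T * p * α := by ring
      _ ≤ y * F * b * α := by gcongr
      _ = y * α * (F * b) := by ring
      _ ≤ (A - g / 2) * p * (F * b) := by gcongr
      _ = _ := by ring
  linarith

set_option maxHeartbeats 2000000 in
/-- The lower bound for a regular channel realization with vanishing error probability. -/
theorem le_ndtAt {H : Channel NT NR} {l s₁ s₂ : ℕ} (hl0 : 1 ≤ l) (hlT : l ≤ NT) (h1 : s₁ ≤ l)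
    (h2 : l + s₂ ≤ NR) (hL : NR ≤ L) (hreg : IsRegularChannel l H)
    (herr : ∀ P : ℝ, 0 < P → Tendsto (fun F : ℕ => (S P F).worstErrorProb H) atTop (𝓝 0)) {θ : ℝ}
    (hcommon : ∀ P : ℝ, 0 < P → ∀ᶠ F : ℕ in atTop, HasCommonParts (S P F) θ) :
    ((1 / l * (((s₁ : ℝ) + s₂) - (NT - l) * s₂ * μT
      - ((2 * s₂ + s₁ + 1) / 2 * s₁ + s₂ ^ 2) * μR
      + ((2 * s₂ + s₁) / 2 * (s₁ - 1) + s₂ ^ 2) * θ) : ℝ) : EReal) ≤ S.ndtAt H := by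
  set A : ℝ := ((s₁ : ℝ) + s₂) - (NT - l) * s₂ * μT
      - ((2 * s₂ + s₁ + 1) / 2 * s₁ + s₂ ^ 2) * μR
      + ((2 * s₂ + s₁) / 2 * (s₁ - 1) + s₂ ^ 2) * θ with hA
  have hlpos : (0 : ℝ) < l := by exact_mod_cast hl0
  have hlog2 : 0 < Real.log 2 := Real.log_pos one_lt_two
  refine EReal.ge_of_forall_gt_iff_ge.1 fun y hy => ?_
  have hyA : y < 1 / l * A := EReal.coe_lt_coe_iff.1 hy
  rcases lt_or_ge y 0 with hy0 | hy0
  · exact le_trans (by exact_mod_cast hy0.le) (S.zero_le_ndtAt H)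
  refine S.le_ndtAt_of_eventually ?_
  have hg : 0 < A - y * l := by
    rw [one_div_mul_eq_div, lt_div_iff₀ hlpos] at hyA
    linarith
  -- The gap is spent in quarters: irreducible slots, constants per slot (large `P`), terms free of
  -- `T` (large `F`), and decoding errors.
  set g := A - y * l with hgdef
  obtain ⟨⟨G, hG⟩, hirr⟩ := hreg
  set ε := g / (4 * (y * NR + 1)) with hε
  have hεpos : 0 < ε := by positivity
  have hεy : y * NR * ε ≤ g / 4 := by
    rw [hε, mul_div_assoc', div_le_div_iff₀ (by positivity) (by norm_num)]
    nlinarith [mul_nonneg hy0 (Nat.cast_nonneg (α := ℝ) NR)]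
  obtain ⟨K, hK, c, hc⟩ := hirr ε hεpos
  set c' := (l + NR * ε) * Real.log 2 + NR * (Real.log 2 + Real.log (4 * (NR ^ 2 * K + 1))) +
    2 * NR * NT + 2 * G with hc'
  have hlogP : Tendsto Real.log atTop atTop := Real.tendsto_log_atTop
  filter_upwards [eventually_ge_atTop 2,
    (hlogP.const_mul_atTop (by positivity : 0 < g / 4)).eventually_ge_atTop (y * c'),
    -- Secures `0 ≤ α` without examining the sign of `c'`.
    (hlogP.const_mul_atTop (by positivity : 0 < (l : ℝ) + NR * ε)).eventually_ge_atTop (-c')]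
    with P hP2 hPc hPα
  have hP0 : 0 < P := by linarith
  have hlP : 0 < Real.log P := Real.log_pos (by linarith)
  set α := (l + NR * ε) * Real.log P + c' with hα
  have hα0 : 0 ≤ α := by linarith
  have hyα : y * α ≤ (A - g / 2) * Real.log P := by
    have : y * NR * ε * Real.log P ≤ g / 4 * Real.log P := by gcongr
    have e : A = g + y * l := by rw [hgdef]; ring
    rw [hα, e]
    linarith
  set β₁ := NR * Real.log (1 + P) * c + (s₁ + s₂) * Real.log 2 with hβ₁
  set δ := g / (4 * ((s₁ : ℝ) + s₂ + 1)) with hδ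
  have hδpos : 0 < δ := by positivity
  have hδs : ((s₁ : ℝ) + s₂) * δ ≤ g / 4 := by
    rw [hδ, mul_div_assoc', div_le_div_iff₀ (by positivity) (by norm_num)]
    have : (0 : ℝ) ≤ s₁ + s₂ := by positivity
    nlinarith
  have hF : Tendsto (fun F : ℕ => g / 4 * Real.log 2 * (F : ℝ)) atTop atTop :=
    tendsto_natCast_atTop_atTop.const_mul_atTop (by positivity)
  filter_upwards [hcommon P hP0, hF.eventually_gt_atTop β₁, eventually_gt_atTop 0,
    (herr P hP0).eventually (gt_mem_nhds (ENNReal.ofReal_pos.2 hδpos))]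
    with F ⟨γ, cc, e, β, k1, k2, k3, k4⟩ hFβ hF0 hFerr
  have hF0' : (0 : ℝ) < F := by exact_mod_cast hF0
  have herr' : ∀ d q, ((S P F).errorProb d q H).toReal ≤ δ := fun d q =>
    ENNReal.toReal_le_of_le_ofReal hδpos.le (((le_iSup
      (fun q => (S P F).errorProb d q H) q).trans (le_iSup
      (fun d => ⨆ q, (S P F).errorProb d q H) d)).trans hFerr.le)
  have main := (S P F).mul_le_infoBound_maxT hlT h1 h2 hL (by omega) hP0 hK H k1 k2 k3 k4 herr'
  have hinfo := infoBound_le (NT := NT) (NR := NR) (P := P) (show (1 : ℝ) ≤ P by linarith)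
    hG hc hεpos.le ((S P F).maxT H)
  rw [Real.logb, div_div_eq_mul_div]
  rw [le_div_iff₀ hF0', ← mul_div_assoc, le_div_iff₀ hlog2]
  refine le_mul_of_info_budget (A := A) (T := ((S P F).maxT H : ℝ)) (α := α) (β := β₁)
    (s := (s₁ : ℝ) + s₂) (δ := δ) (g := g) hα0 hlP hF0' hlog2 hδs hyα hFβ ?_
  rw [hA]
  linarith

end CachingScheme

/-! ### Assembly of the two bounds -/

instance {NT NR : ℕ} (ν : Measure ℂ) [IsProbabilityMeasure ν] (fading : Fading) :
    IsProbabilityMeasure (channelLaw NT NR ν fading) := by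
  cases fading with
  | timeVarying => unfold channelLaw; infer_instance
  | static =>
    exact Measure.isProbabilityMeasure_map
      (measurable_pi_lambda _ fun _ => measurable_id).aemeasurable

theorem le_essSup_of_ae_le {α : Type*} [MeasurableSpace α] {κ : Measure α} [NeZero κ]
    {f : α → EReal} {x : EReal} (h : ∀ᵐ a ∂κ, x ≤ f a) : x ≤ essSup f κ :=
  le_limsup_of_frequently_le' h.frequently

/-- The maximum over finitely many triples is attained, so the bound is needed only at one
maximizing triple. -/
theorem sSup_mem_bounds {NT NR : ℕ} (hNT : 1 ≤ NT) (hNR : 1 ≤ NR) (f : ℕ → ℕ → ℕ → ℝ) :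
    sSup {x | ∃ l s₁ s₂ : ℕ, 1 ≤ l ∧ l ≤ min NT NR ∧ s₁ ≤ l ∧ s₂ ≤ NR - l ∧ x = f l s₁ s₂} ∈
      {x | ∃ l s₁ s₂ : ℕ, 1 ≤ l ∧ l ≤ min NT NR ∧ s₁ ≤ l ∧ s₂ ≤ NR - l ∧ x = f l s₁ s₂} := by
  refine Set.Nonempty.csSup_mem ⟨f 1 0 0, 1, 0, 0, le_rfl, le_min hNT hNR, Nat.zero_le _,
    Nat.zero_le _, rfl⟩ ?_
  refine (((Set.finite_Iic NT).prod ((Set.finite_Iic NT).prod (Set.finite_Iic NR))).image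
    fun z => f z.1 z.2.1 z.2.2).subset ?_
  rintro x ⟨l, s₁, s₂, -, hl, h1, h2, rfl⟩
  rw [le_min_iff] at hl
  exact ⟨(l, s₁, s₂), ⟨hl.1, h1.trans hl.1, h2.trans (Nat.sub_le _ _)⟩, rfl⟩

theorem theorem2 (NT NR L : ℕ) (hNT : 2 ≤ NT) (hNR : 2 ≤ NR) (hL : NR ≤ L)
    (μT μR : ℝ) (hμT : 0 ≤ μT) (hμR : 0 ≤ μR)
    (ν : Measure ℂ) [IsProbabilityMeasure ν] [NullSingletonClass ν] (fading : Fading)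
    (hν : fading = Fading.timeVarying → Integrable (fun h : ℂ => Real.log (1 + ‖h‖)) ν) :
    ((tauL1 NT NR μT μR : ℝ) : EReal) ≤ minNDT NT NR L μT μR (channelLaw NT NR ν fading) ∧
    ((tauL2 NT NR μT μR : ℝ) : EReal) ≤
      minNDTUncoded NT NR L μT μR (channelLaw NT NR ν fading) := by
  constructor
  · refine le_sInf ?_
    rintro τ ⟨S, hS, rfl⟩
    obtain ⟨l, s₁, s₂, hl0, hl, h1, h2, hx⟩ := sSup_mem_bounds (NT := NT) (NR := NR)
      (by omega) (by omega) fun l s₁ s₂ => 1 / l * (((s₁ : ℝ) + s₂) - (NT - l) * s₂ * μT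
        - ((2 * s₂ + s₁ + 1) / 2 * s₁ + s₂ ^ 2) * μR)
    rw [le_min_iff] at hl
    have h2' : l + s₂ ≤ NR := by omega
    rw [tauL1, hx]
    refine le_essSup_of_ae_le ?_
    filter_upwards [hS, ae_isRegularChannel hl.2 hl.1 ν fading hν] with H hH hreg
    have := S.le_ndtAt hl0 hl.1 h1 h2' hL hreg hH (θ := 0) fun P _ =>
      Eventually.of_forall fun F => hasCommonParts_zero _
    simpa using this
  · refine le_sInf ?_
    rintro τ ⟨S, hS, hun, rfl⟩
    obtain ⟨l, s₁, s₂, hl0, hl, h1, h2, hx⟩ := sSup_mem_bounds (NT := NT) (NR := NR)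
      (by omega) (by omega) fun l s₁ s₂ => 1 / l * (((s₁ : ℝ) + s₂) - (NT - l) * s₂ * μT
        - ((2 * s₂ + s₁ + 1) / 2 * s₁ + s₂ ^ 2) * μR
        + ((2 * s₂ + s₁) / 2 * (s₁ - 1) + s₂ ^ 2) * max (1 - NT * μT) 0)
    rw [le_min_iff] at hl
    have h2' : l + s₂ ≤ NR := by omega
    rw [tauL2, hx]
    refine le_essSup_of_ae_le ?_
    filter_upwards [hS, ae_isRegularChannel hl.2 hl.1 ν fading hν] with H hH hreg
    refine S.le_ndtAt hl0 hl.1 h1 h2' hL hreg hH fun P hP => ?_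
    -- An error probability below one half is what the bit-flipping argument requires, and
    -- feasibility provides it for all large `F`.
    filter_upwards [(hH P hP).eventually (gt_mem_nhds (ENNReal.half_pos one_ne_zero))] with F hF
    exact hasCommonParts_of_uncoded _ (hun P F).1 (hun P F).2 H hF
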